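/- Let $B$ be a smooth manifold with a Riemannian metric $g$, and let $\pi: M \to B$ be a flat $\mathbb{R}^N$-vector bundle: a vector bundle with an atlas of linear trivializations (flat frames) whose transition functions are locally constant. Let each fiber carry an inner product depending smoothly on the base point, with Gram matrix $G = (g_{ij})$ in a flat local frame; $G$ is a locally defined map from $B$ to the positive-definite symmetric $N\times N$ matrices. Assume that the flat connection preserves the fiberwise volume forms, i.e. $\det G$ is locally constant in every flat frame. Let $\overline g$ be the canonical metric on the total space $M$, which in local coordinates $(x^\alpha, x^i)$ ($x^\alpha$ coordinates on $B$, $x^i$ the linear fiber coordinates of a flat frame) is $$\overline g = g_{\alpha\beta}\, dx^\alpha dx^\beta + g_{ij}\, dx^i dx^j .$$ Let $t>0$ and let $V(t) = -\frac{1}{2t} \sum_{i=1}^N x^i \frac{\partial}{\partial x^i}$. Then the expanding soliton equation $$\operatorname{Ric}(\overline g) + \tfrac12 \mathcal{L}_{V(t)}\, \overline g + \frac{1}{2t}\, \overline g = 0$$ holds on $M$ if and only if both of the following hold on $B$: 1. The map $G$ is harmonic. That is, in flat frames and near each point of $B$, $G$ is a harmonic map into the space of positive-definite symmetric matrices of some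 fixed determinant, which is identified with $\operatorname{SL}(N,\mathbb{R})/\operatorname{SO}(N)$ and has the metric $\langle K, L\rangle_G = \operatorname{Tr}(G^{-1} K G^{-1} L)$. Harmonic means a smooth critical point, under smooth compactly supported variations, of the energy $\frac12 \int g^{\alpha\beta} \operatorname{Tr}(G^{-1} G_{,\alpha} G^{-1} G_{,\beta})\, d\mathrm{vol}$. 2. $$R_{\alpha\beta} - \frac14 \operatorname{Tr}\left(G^{-1} G_{,\alpha} G^{-1} G_{,\beta}\right) + \frac{1}{2t}\, g_{\alpha\beta} = 0,$$ where $R_{\alpha\beta}$ is the Ricci tensor of $g$ and $G_{,\alpha}$ is the partial derivative in a flat frame. -/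

import Mathlib

open Bundle Manifold Set Topology MeasureTheory
open scoped ContDiff Manifold

noncomputable section

namespace FlatSoliton

/-! ### Riemannian geometry in coordinates

`W` is the model vector space, `β` a basis of it; `β` supplies the linear coordinates and
the coordinate vector fields. A metric is given by its matrix of components. -/

section Coordinates

/-- Partial derivative `∂_k f` of a scalar function in the direction of the `k`-th basis vector. -/
def pd {W ι : Type*} [NormedAddCommGroup W] [NormedSpace ℝ W] (β : Module.Basis ι ℝ W)
    (k : ι) (f : W → ℝ) (y : W) : ℝ :=
  fderiv ℝ f y (β k)

/-- Entrywise partial derivative of a matrix-valued function. -/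
def pdMat {W ι m : Type*} [NormedAddCommGroup W] [NormedSpace ℝ W] (β : Module.Basis ι ℝ W)
    (k : ι) (F : W → Matrix m m ℝ) (y : W) : Matrix m m ℝ :=
  Matrix.of fun i j => pd β k (fun z => F z i j) y

/-- Christoffel symbols
`Γ^k_{ij} = ½ g^{kl} (∂_i g_{jl} + ∂_j g_{il} - ∂_l g_{ij})` of the Levi-Civita connection. -/
def christoffel {W ι : Type*} [NormedAddCommGroup W] [NormedSpace ℝ W] [Fintype ι]
    [DecidableEq ι] (β : Module.Basis ι ℝ W) (g : W → Matrix ι ι ℝ) (k i j : ι) (y : W) : ℝ :=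
  (1 / 2) * ∑ l, (g y)⁻¹ k l *
    (pd β i (fun z => g z j l) y + pd β j (fun z => g z i l) y - pd β l (fun z => g z i j) y)

/-- Ricci tensor
`R_{ij} = ∂_k Γ^k_{ij} - ∂_j Γ^k_{ik} + Γ^k_{kl} Γ^l_{ij} - Γ^k_{jl} Γ^l_{ik}`
(positive on round spheres). -/
def ricci {W ι : Type*} [NormedAddCommGroup W] [NormedSpace ℝ W] [Fintype ι]
    [DecidableEq ι] (β : Module.Basis ι ℝ W) (g : W → Matrix ι ι ℝ) (y : W) : Matrix ι ι ℝ :=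
  Matrix.of fun i j =>
    (∑ k, pd β k (christoffel β g k i j) y) - (∑ k, pd β j (christoffel β g k i k) y)
      + (∑ k, ∑ l, christoffel β g k k l y * christoffel β g l i j y)
      - ∑ k, ∑ l, christoffel β g k j l y * christoffel β g l i k y

/-- Lie derivative
`(L_V g)_{ij} = V^k ∂_k g_{ij} + g_{kj} ∂_i V^k + g_{ik} ∂_j V^k` of the metric. -/
def lieDerivMetric {W ι : Type*} [NormedAddCommGroup W] [NormedSpace ℝ W] [Fintype ι]
    (β : Module.Basis ι ℝ W) (g : W → Matrix ι ι ℝ) (V : W → ι → ℝ) (y : W) : Matrix ι ι ℝ :=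
  Matrix.of fun i j =>
    ∑ k, (V y k * pd β k (fun z => g z i j) y
      + g y k j * pd β i (fun z => V z k) y + g y i k * pd β j (fun z => V z k) y)

end Coordinates

/-! ### Tensors on a manifold, read in its charts, and the expanding soliton equation -/

section Manifold

/-- The components of a covariant 2-tensor `g` on `X` with respect to the coordinate vector
fields of the chart centred at `p`, as a function of the coordinates. -/
def chartMetric {W H X ι : Type*} [NormedAddCommGroup W] [NormedSpace ℝ W] [TopologicalSpace H]
    [TopologicalSpace X] [ChartedSpace H X] (I : ModelWithCorners ℝ W H)
    (β : Module.Basis ι ℝ W) (g : ∀ x : X, TangentSpace I x → TangentSpace I x → ℝ) (p : X)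
    (y : W) : Matrix ι ι ℝ :=
  Matrix.of fun i j =>
    g ((extChartAt I p).symm y)
      (mfderiv 𝓘(ℝ, W) I (extChartAt I p).symm y (β i))
      (mfderiv 𝓘(ℝ, W) I (extChartAt I p).symm y (β j))

/-- The components of a vector field `V` on `X` in the chart centred at `p`. -/
def chartField {W H X ι : Type*} [NormedAddCommGroup W] [NormedSpace ℝ W] [TopologicalSpace H]
    [TopologicalSpace X] [ChartedSpace H X] (I : ModelWithCorners ℝ W H)
    (β : Module.Basis ι ℝ W) (V : ∀ x : X, TangentSpace I x) (p : X) (y : W) (k : ι) : ℝ :=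
  β.repr (mfderiv I 𝓘(ℝ, W) (extChartAt I p) ((extChartAt I p).symm y)
    (V ((extChartAt I p).symm y))) k

/-- The expanding soliton equation at time `t`,
`Ric + ½ L_V g + g / (2t) = 0`, for a metric `g` and a vector field `V` on a manifold without
boundary: an equality of tensors, read at all points of all the charts `extChartAt I p`. -/
def ExpandingSolitonEq {W H X ι : Type*} [NormedAddCommGroup W] [NormedSpace ℝ W]
    [TopologicalSpace H] [TopologicalSpace X] [ChartedSpace H X] [Fintype ι] [DecidableEq ι]
    (I : ModelWithCorners ℝ W H) (β : Module.Basis ι ℝ W)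
    (g : ∀ x : X, TangentSpace I x → TangentSpace I x → ℝ) (V : ∀ x : X, TangentSpace I x)
    (t : ℝ) : Prop :=
  ∀ p : X, ∀ y ∈ (extChartAt I p).target,
    ricci β (chartMetric I β g p) y
      + (1 / 2 : ℝ) • lieDerivMetric β (chartMetric I β g p) (chartField I β V p) y
      + (1 / (2 * t)) • chartMetric I β g p y = 0

end Manifold

/-! ### Harmonic maps into `SL(N, ℝ) / SO(N)` -/

section Harmonic

/-- The standard basis of `ℝⁿ`. -/
abbrev stdBasis (n : ℕ) : Module.Basis (Fin n) ℝ (EuclideanSpace ℝ (Fin n)) :=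
  (EuclideanSpace.basisFun (Fin n) ℝ).toBasis

/-- The positive-definite symmetric `N × N` matrices of determinant `c`; for `c > 0` this is the
symmetric space `SL(N, ℝ) / SO(N)`, the group acting by `G ↦ A G Aᵀ`. -/
def spdDet (N : ℕ) (c : ℝ) : Set (Matrix (Fin N) (Fin N) ℝ) :=
  {G | G.PosDef ∧ G.det = c}

/-- The invariant Riemannian metric `⟨K, L⟩_G = Tr (G⁻¹ K G⁻¹ L)` on that space. -/
def spdMetric {N : ℕ} (G K L : Matrix (Fin N) (Fin N) ℝ) : ℝ :=
  (G⁻¹ * K * G⁻¹ * L).trace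

/-- The energy density `½ g^{αβ} ⟨∂_α F, ∂_β F⟩_F` of a map `F` into the positive-definite
symmetric matrices. -/
def energyDensity {n N : ℕ} (g : EuclideanSpace ℝ (Fin n) → Matrix (Fin n) (Fin n) ℝ)
    (F : EuclideanSpace ℝ (Fin n) → Matrix (Fin N) (Fin N) ℝ)
    (y : EuclideanSpace ℝ (Fin n)) : ℝ :=
  (1 / 2) * ∑ a, ∑ b, (g y)⁻¹ a b *
    spdMetric (F y) (pdMat (stdBasis n) a F y) (pdMat (stdBasis n) b F y)

/-- The energy over `K`, with respect to the Riemannian measure `√(det g) dy`. -/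
def energy {n N : ℕ} (g : EuclideanSpace ℝ (Fin n) → Matrix (Fin n) (Fin n) ℝ)
    (K : Set (EuclideanSpace ℝ (Fin n)))
    (F : EuclideanSpace ℝ (Fin n) → Matrix (Fin N) (Fin N) ℝ) : ℝ :=
  ∫ y in K, energyDensity g F y * Real.sqrt (g y).det

/-- `G` is a harmonic map from the open set `Ω ⊆ ℝⁿ` with Riemannian metric `g` to
`SL(N, ℝ) / SO(N)`, realized as `spdDet N c`: it is a smooth map and a critical point of the
energy under all smooth compactly supported variations through maps into `spdDet N c`. -/
structure IsHarmonicMapOn {n N : ℕ} (Ω : Set (EuclideanSpace ℝ (Fin n)))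
    (g : EuclideanSpace ℝ (Fin n) → Matrix (Fin n) (Fin n) ℝ) (c : ℝ)
    (G : EuclideanSpace ℝ (Fin n) → Matrix (Fin N) (Fin N) ℝ) : Prop where
  smooth : ∀ i j, ContDiffOn ℝ ∞ (fun y => G y i j) Ω
  mapsTo : MapsTo G Ω (spdDet N c)
  critical : ∀ K : Set (EuclideanSpace ℝ (Fin n)), IsCompact K → K ⊆ Ω →
    ∀ ε : ℝ, 0 < ε →
    ∀ F : ℝ → EuclideanSpace ℝ (Fin n) → Matrix (Fin N) (Fin N) ℝ,
      (∀ i j, ContDiffOn ℝ ∞ (fun q : ℝ × EuclideanSpace ℝ (Fin n) => F q.1 q.2 i j)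
        (Ioo (-ε) ε ×ˢ Ω)) →
      (∀ s ∈ Ioo (-ε) ε, MapsTo (F s) Ω (spdDet N c)) →
      (∀ y ∈ Ω, F 0 y = G y) →
      (∀ s ∈ Ioo (-ε) ε, ∀ y ∈ Ω \ K, F s y = G y) →
      HasDerivAt (fun s => energy g K (F s)) 0 0

end Harmonic

/-! ### Flat vector bundles with fibre metrics -/

section FlatBundle

/-- A flat structure on a vector bundle: the transition functions of its trivialization atlas are
locally constant. The sections that are constant in a trivialization of the atlas are the local
parallel sections of the flat connection. -/
class FlatVectorBundle {B : Type*} [TopologicalSpace B] (F : Type*) [NormedAddCommGroup F]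
    [NormedSpace ℝ F] (E : B → Type*) [∀ b, AddCommGroup (E b)] [∀ b, Module ℝ (E b)]
    [∀ b, TopologicalSpace (E b)] [TopologicalSpace (TotalSpace F E)] [FiberBundle F E]
    [VectorBundle ℝ F E] : Prop where
  locallyConstant_coordChange :
    ∀ (e e' : Trivialization F (π F E)) [MemTrivializationAtlas e] [MemTrivializationAtlas e'],
      ∀ b ∈ e.baseSet ∩ e'.baseSet, ∀ᶠ b' in 𝓝 b,
        (e.coordChangeL ℝ e' b' : F →L[ℝ] F) = (e.coordChangeL ℝ e' b : F →L[ℝ] F)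

variable {n N : ℕ} {B : Type*} [TopologicalSpace B] [ChartedSpace (EuclideanSpace ℝ (Fin n)) B]
  {E : B → Type*} [∀ b, AddCommGroup (E b)] [∀ b, Module ℝ (E b)]
  [∀ b, TopologicalSpace (E b)] [TopologicalSpace (TotalSpace (EuclideanSpace ℝ (Fin N)) E)]
  [FiberBundle (EuclideanSpace ℝ (Fin N)) E] [VectorBundle ℝ (EuclideanSpace ℝ (Fin N)) E]

/-- The Gram matrix `G_{ij}(b) = h_b(e_i, e_j)` of fibre metrics `h` in the frame given by a
linear trivialization `e`. -/
def gram (h : ∀ b : B, E b → E b → ℝ)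
    (e : Trivialization (EuclideanSpace ℝ (Fin N)) (π (EuclideanSpace ℝ (Fin N)) E))
    (b : B) : Matrix (Fin N) (Fin N) ℝ :=
  Matrix.of fun i j => h b (e.symm b (stdBasis N i)) (e.symm b (stdBasis N j))

/-- The flat connection preserves the fibrewise volume forms: in every flat local frame the
volume `√(det G)` of the frame is locally constant. -/
def VolumePreserving (h : ∀ b : B, E b → E b → ℝ) : Prop :=
  ∀ (e : Trivialization (EuclideanSpace ℝ (Fin N)) (π (EuclideanSpace ℝ (Fin N)) E))
    [MemTrivializationAtlas e],
    ∀ b ∈ e.baseSet, ∀ᶠ b' in 𝓝 b, (gram h e b').det = (gram h e b).det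

/-- The model with corners of the total space, which is modelled on `ℝⁿ × ℝᴺ`. -/
abbrev totalModel (n N : ℕ) :=
  (𝓡 n).prod 𝓘(ℝ, EuclideanSpace ℝ (Fin N))

/-- The basis of `ℝⁿ × ℝᴺ` formed by the two standard bases. -/
abbrev totalBasis (n N : ℕ) :
    Module.Basis (Fin n ⊕ Fin N) ℝ (EuclideanSpace ℝ (Fin n) × EuclideanSpace ℝ (Fin N)) :=
  (stdBasis n).prod (stdBasis N)

/-- The vertical part `T_p M → E_{π p}` of a tangent vector of the total space: its projection
along the horizontal space of the flat connection, that is, the derivative of the fibre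
coordinate of a flat trivialization. -/
def verticalPart (p : TotalSpace (EuclideanSpace ℝ (Fin N)) E)
    (u : TangentSpace (totalModel n N) p) : E p.proj :=
  (trivializationAt (EuclideanSpace ℝ (Fin N)) E p.proj).symm p.proj
    (mfderiv (totalModel n N) 𝓘(ℝ, EuclideanSpace ℝ (Fin N))
      (fun q : TotalSpace (EuclideanSpace ℝ (Fin N)) E =>
        (trivializationAt (EuclideanSpace ℝ (Fin N)) E p.proj q).2) p u)

/-- The canonical metric on the total space `M`: horizontal and vertical spaces are orthogonal,
`M → B` is a Riemannian submersion, and the fibres carry the flat metrics given by `h`. -/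
def totalMetric (g : ∀ b : B, TangentSpace (𝓡 n) b → TangentSpace (𝓡 n) b → ℝ)
    (h : ∀ b : B, E b → E b → ℝ) (p : TotalSpace (EuclideanSpace ℝ (Fin N)) E)
    (u v : TangentSpace (totalModel n N) p) : ℝ :=
  g p.proj
      (mfderiv (totalModel n N) (𝓡 n) (π (EuclideanSpace ℝ (Fin N)) E) p u)
      (mfderiv (totalModel n N) (𝓡 n) (π (EuclideanSpace ℝ (Fin N)) E) p v)
    + h p.proj (verticalPart p u) (verticalPart p v)

/-- The vector field `x^i ∂/∂x^i` on the total space: the velocity at `s = 1` of the curve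
`s ↦ s • p` in the fibre through `p`. -/
def radialField (p : TotalSpace (EuclideanSpace ℝ (Fin N)) E) :
    TangentSpace (totalModel n N) p :=
  (mfderiv 𝓘(ℝ, ℝ) (totalModel n N)
    (fun s : ℝ => (⟨p.proj, s • p.snd⟩ : TotalSpace (EuclideanSpace ℝ (Fin N)) E)) 1 (1 : ℝ) :
      EuclideanSpace ℝ (Fin n) × EuclideanSpace ℝ (Fin N))

/-- The part of the chart of `B` centred at `b` over which the flat trivialization at `b` is
defined, in coordinates. -/
def flatDomain (n N : ℕ) {B : Type*} [TopologicalSpace B]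
    [ChartedSpace (EuclideanSpace ℝ (Fin n)) B] (E : B → Type*)
    [∀ b, TopologicalSpace (E b)] [TopologicalSpace (TotalSpace (EuclideanSpace ℝ (Fin N)) E)]
    [FiberBundle (EuclideanSpace ℝ (Fin N)) E] (b : B) : Set (EuclideanSpace ℝ (Fin n)) :=
  (extChartAt (𝓡 n) b).target ∩
    (extChartAt (𝓡 n) b).symm ⁻¹' (trivializationAt (EuclideanSpace ℝ (Fin N)) E b).baseSet

/-- The fibre metric map `G` in the flat trivialization and the chart centred at `b`. -/
def localG (h : ∀ b : B, E b → E b → ℝ) (b : B) (y : EuclideanSpace ℝ (Fin n)) :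
    Matrix (Fin N) (Fin N) ℝ :=
  gram h (trivializationAt (EuclideanSpace ℝ (Fin N)) E b) ((extChartAt (𝓡 n) b).symm y)

/-- The fibre metrics, in flat frames, form a harmonic map to `SL(N, ℝ) / SO(N)`: near every point
of every flat coordinate domain, `G` is a harmonic map into the positive-definite symmetric
matrices of some fixed determinant. -/
def FiberMetricHarmonic (g : ∀ b : B, TangentSpace (𝓡 n) b → TangentSpace (𝓡 n) b → ℝ)
    (h : ∀ b : B, E b → E b → ℝ) : Prop :=
  ∀ b : B, ∀ y₀ ∈ flatDomain n N E b, ∃ (c : ℝ) (Ω : Set (EuclideanSpace ℝ (Fin n))),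
    IsOpen Ω ∧ y₀ ∈ Ω ∧ Ω ⊆ flatDomain n N E b ∧
      IsHarmonicMapOn Ω (chartMetric (𝓡 n) (stdBasis n) g b) c (localG (N := N) h b)

/-- The equation
`R_{αβ} - ¼ Tr (G⁻¹ G_{,α} G⁻¹ G_{,β}) + g_{αβ} / (2t) = 0` on `B`. -/
def BaseEq (g : ∀ b : B, TangentSpace (𝓡 n) b → TangentSpace (𝓡 n) b → ℝ)
    (h : ∀ b : B, E b → E b → ℝ) (t : ℝ) : Prop :=
  ∀ b : B, ∀ y ∈ flatDomain n N E b, ∀ α β : Fin n,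
    ricci (stdBasis n) (chartMetric (𝓡 n) (stdBasis n) g b) y α β
      - (1 / 4) * ((localG (N := N) h b y)⁻¹ * pdMat (stdBasis n) α (localG (N := N) h b) y
          * (localG (N := N) h b y)⁻¹ * pdMat (stdBasis n) β (localG (N := N) h b) y).trace
      + (1 / (2 * t)) * chartMetric (𝓡 n) (stdBasis n) g b y α β = 0

end FlatBundle

end FlatSoliton

end

set_option linter.unusedSectionVars false

/-! In a flat chart the metric on $M$ is the block matrix $\operatorname{diag}(g(y), G(y))$, whose
coefficients do not depend on the fibre coordinates, so its Ricci tensor can be computed outright.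
Local constancy of $\det G$ gives $\operatorname{Tr}(G^{-1}\partial_a G) = 0$, which removes every
trace term. The horizontal block is then $R_{ab} - \frac14 \operatorname{Tr}(G^{-1}\partial_a G\,
G^{-1}\partial_b G)$ (`LocalData.ricci_block_ll`), the mixed blocks vanish, and $\sqrt{\det g}$
times the vertical block is $-\frac12\, G D$ with $D = \partial_a(\sqrt{\det g}\, g^{ab}
G^{-1}\partial_b G)$ (`LocalData.ricci_block_rr`).

The vector field $-\frac{1}{2t}x^i\partial_i$ scales the fibres, and $\frac12\mathcal L_V$ of the
metric is $-\frac{1}{2t}G$ on the fibre block and zero elsewhere. It cancels the expansion term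
there, so the soliton equation splits into $D = 0$ and the equation on the base
(`LocalData.soliton_block_iff`).

It remains to identify $D = 0$ with harmonicity. With $L = F^{-1}\partial_s F$ at $s = 0$, the first
variation of the energy is $-\int \operatorname{Tr}(L D)$ (`LocalData.hasDerivAt_energy`), so $D =
0$ implies criticality. Conversely, the variations $(1 + s\varphi A)^T G (1 + s\varphi A)$ with $A =
u v^T$, $v\cdot u = 0$, keep the determinant fixed and yield $\operatorname{Tr}(A D) = 0$ pointwise;
since $D$ is trace-free, it vanishes (`LocalData.eulerLagrange_eq_zero`).

The passage from the bundle to block metrics is `chartMetric_total` and `chartField_radialField`.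
Flatness enters through `verticalPart_mfderiv_symm`: a locally constant change of frame creates no
base component in the vertical part. -/

namespace FlatSoliton

/-! ### Calculus of matrix-valued functions -/

section MatrixCalculus

variable {W W' : Type*} [NormedAddCommGroup W] [NormedSpace ℝ W] [NormedAddCommGroup W']
  [NormedSpace ℝ W'] {m p q : Type*}

/-- Entrywise smoothness at a point of a matrix-valued function. -/
def MatSmoothAt (F : W → Matrix m p ℝ) (y : W) : Prop :=
  ∀ i j, ContDiffAt ℝ ∞ (fun z => F z i j) y

/-- Entrywise derivative of a matrix-valued function in the direction `v`. -/
noncomputable def dMat (v : W) (F : W → Matrix m p ℝ) (y : W) : Matrix m p ℝ :=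
  Matrix.of fun i j => fderiv ℝ (fun z => F z i j) y v

theorem pdMat_eq_dMat {ι : Type*} (β : Module.Basis ι ℝ W) (k : ι) (F : W → Matrix m m ℝ) (y : W) :
    pdMat β k F y = dMat (β k) F y := rfl

theorem dMat_apply (v : W) (F : W → Matrix m p ℝ) (y : W) (i : m) (j : p) :
    dMat v F y i j = fderiv ℝ (fun z => F z i j) y v := rfl

theorem contDiffAt_differentiableAt {f : W → ℝ} {y : W} (hf : ContDiffAt ℝ ∞ f y) :
    DifferentiableAt ℝ f y := hf.differentiableAt (by simp)

theorem contDiffAt_fderiv_apply {f : W → ℝ} {y : W} (hf : ContDiffAt ℝ ∞ f y) (v : W) :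
    ContDiffAt ℝ ∞ (fun z => fderiv ℝ f z v) y :=
  (hf.fderiv_right (m := ∞) (by simp)).clm_apply contDiffAt_const

theorem fderiv_fderiv_comm {f : W → ℝ} {y : W} (hf : ContDiffAt ℝ ∞ f y) (v w : W) :
    fderiv ℝ (fun z => fderiv ℝ f z v) y w = fderiv ℝ (fun z => fderiv ℝ f z w) y v := by
  have hd : DifferentiableAt ℝ (fderiv ℝ f) y :=
    (hf.fderiv_right (m := ∞) (by simp)).differentiableAt (by simp)
  have key : ∀ u, fderiv ℝ (fun z => fderiv ℝ f z u) y = (fderiv ℝ (fderiv ℝ f) y).flip u := by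
    intro u
    rw [fderiv_clm_apply hd (differentiableAt_const u)]
    simp
  rw [key, key]
  exact (hf.isSymmSndFDerivAt (by simpa using ENat.LEInfty.out)).eq w v

theorem fderiv_mul_apply {f g : W → ℝ} {y : W} (hf : ContDiffAt ℝ ∞ f y)
    (hg : ContDiffAt ℝ ∞ g y) (v : W) :
    fderiv ℝ (fun z => f z * g z) y v = fderiv ℝ f y v * g y + f y * fderiv ℝ g y v := by
  rw [fderiv_fun_mul (contDiffAt_differentiableAt hf) (contDiffAt_differentiableAt hg)]
  simp only [add_apply, smul_apply, smul_eq_mul]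
  ring

theorem fderiv_sum_apply {ι : Type*} {s : Finset ι} {f : ι → W → ℝ} {y : W}
    (hf : ∀ i ∈ s, ContDiffAt ℝ ∞ (f i) y) (v : W) :
    fderiv ℝ (fun z => ∑ i ∈ s, f i z) y v = ∑ i ∈ s, fderiv ℝ (f i) y v := by
  rw [fderiv_fun_sum fun i hi => contDiffAt_differentiableAt (hf i hi)]
  simp

theorem contDiffAt_finset_sum {ι : Type*} {s : Finset ι} {f : ι → W → ℝ} {y : W}
    (hf : ∀ i ∈ s, ContDiffAt ℝ ∞ (f i) y) : ContDiffAt ℝ ∞ (fun z => ∑ i ∈ s, f i z) y :=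
  ContDiffAt.sum hf

theorem dMat_congr {F H : W → Matrix m p ℝ} {y : W} (h : H =ᶠ[𝓝 y] F) (v : W) :
    dMat v H y = dMat v F y := by
  ext i j
  simp only [dMat_apply]
  rw [Filter.EventuallyEq.fderiv_eq (f₁ := fun z => H z i j) (f := fun z => F z i j)
    (h.mono fun z hz => by simp only [hz])]

theorem MatSmoothAt.dMat {F : W → Matrix m p ℝ} {y : W} (hF : MatSmoothAt F y) (v : W) :
    MatSmoothAt (dMat v F) y := fun i j => contDiffAt_fderiv_apply (hF i j) v

theorem dMat_comm {F : W → Matrix m p ℝ} {y : W} (hF : MatSmoothAt F y) (v w : W) :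
    dMat v (dMat w F) y = dMat w (dMat v F) y := by
  ext i j
  exact fderiv_fderiv_comm (hF i j) w v

theorem matSmoothAt_const (A : Matrix m p ℝ) (y : W) : MatSmoothAt (fun _ => A) y :=
  fun _ _ => contDiffAt_const

theorem dMat_const (v : W) (A : Matrix m p ℝ) (y : W) : dMat v (fun _ => A) y = 0 := by
  ext i j
  simp [dMat_apply]

theorem MatSmoothAt.add {F H : W → Matrix m p ℝ} {y : W} (hF : MatSmoothAt F y)
    (hH : MatSmoothAt H y) : MatSmoothAt (fun z => F z + H z) y :=
  fun i j => (hF i j).add (hH i j)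

theorem dMat_add {F H : W → Matrix m p ℝ} {y : W} (hF : MatSmoothAt F y)
    (hH : MatSmoothAt H y) (v : W) :
    dMat v (fun z => F z + H z) y = dMat v F y + dMat v H y := by
  ext i j
  simp only [dMat_apply, Matrix.add_apply]
  rw [fderiv_fun_add (contDiffAt_differentiableAt (hF i j)) (contDiffAt_differentiableAt (hH i j))]
  rfl

theorem MatSmoothAt.smul {f : W → ℝ} {F : W → Matrix m p ℝ} {y : W} (hf : ContDiffAt ℝ ∞ f y)
    (hF : MatSmoothAt F y) : MatSmoothAt (fun z => f z • F z) y :=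
  fun i j => hf.mul (hF i j)

theorem dMat_smul {f : W → ℝ} {F : W → Matrix m p ℝ} {y : W} (hf : ContDiffAt ℝ ∞ f y)
    (hF : MatSmoothAt F y) (v : W) :
    dMat v (fun z => f z • F z) y = fderiv ℝ f y v • F y + f y • dMat v F y := by
  ext i j
  simp only [dMat_apply, Matrix.add_apply, Matrix.smul_apply, smul_eq_mul]
  exact fderiv_mul_apply hf (hF i j) v

theorem MatSmoothAt.sum {ι : Type*} {s : Finset ι} {F : ι → W → Matrix m p ℝ} {y : W}
    (hF : ∀ k ∈ s, MatSmoothAt (F k) y) : MatSmoothAt (fun z => ∑ k ∈ s, F k z) y := by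
  intro i j
  simp only [Matrix.sum_apply]
  exact contDiffAt_finset_sum fun k hk => hF k hk i j

theorem MatSmoothAt.transpose {F : W → Matrix m p ℝ} {y : W} (hF : MatSmoothAt F y) :
    MatSmoothAt (fun z => (F z).transpose) y := fun i j => hF j i

theorem dMat_transpose (v : W) (F : W → Matrix m p ℝ) (y : W) :
    dMat v (fun z => (F z).transpose) y = (dMat v F y).transpose := rfl

theorem MatSmoothAt.comp {F : W' → Matrix m p ℝ} {f : W → W'} {y : W}
    (hF : MatSmoothAt F (f y)) (hf : ContDiffAt ℝ ∞ f y) : MatSmoothAt (fun z => F (f z)) y :=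
  fun i j => (hF i j).comp y hf

theorem dMat_comp {F : W' → Matrix m p ℝ} {f : W → W'} {y : W}
    (hF : MatSmoothAt F (f y)) (hf : ContDiffAt ℝ ∞ f y) (v : W) :
    dMat v (fun z => F (f z)) y = dMat (fderiv ℝ f y v) F (f y) := by
  ext i j
  simp only [dMat_apply]
  rw [fderiv_fun_comp (f := f) (g := fun z => F z i j) y (contDiffAt_differentiableAt (hF i j))
    (hf.differentiableAt (by simp))]
  rfl

theorem MatSmoothAt.mul [Fintype p] {F : W → Matrix m p ℝ} {H : W → Matrix p q ℝ} {y : W}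
    (hF : MatSmoothAt F y) (hH : MatSmoothAt H y) : MatSmoothAt (fun z => F z * H z) y := by
  intro i j
  simp only [Matrix.mul_apply]
  exact contDiffAt_finset_sum fun k _ => (hF i k).mul (hH k j)

theorem dMat_mul [Fintype p] {F : W → Matrix m p ℝ} {H : W → Matrix p q ℝ} {y : W}
    (hF : MatSmoothAt F y) (hH : MatSmoothAt H y) (v : W) :
    dMat v (fun z => F z * H z) y = dMat v F y * H y + F y * dMat v H y := by
  ext i j
  simp only [dMat_apply, Matrix.mul_apply, Matrix.add_apply]
  rw [fderiv_sum_apply fun k _ => (hF i k).mul (hH k j), ← Finset.sum_add_distrib]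
  exact Finset.sum_congr rfl fun k _ => fderiv_mul_apply (hF i k) (hH k j) v

variable [Fintype m]

theorem MatSmoothAt.trace {F : W → Matrix m m ℝ} {y : W} (hF : MatSmoothAt F y) :
    ContDiffAt ℝ ∞ (fun z => (F z).trace) y :=
  contDiffAt_finset_sum fun k _ => hF k k

theorem fderiv_trace {F : W → Matrix m m ℝ} {y : W} (hF : MatSmoothAt F y) (v : W) :
    fderiv ℝ (fun z => (F z).trace) y v = (dMat v F y).trace :=
  fderiv_sum_apply (fun k _ => hF k k) v

variable [DecidableEq m]

theorem MatSmoothAt.det {F : W → Matrix m m ℝ} {y : W} (hF : MatSmoothAt F y) :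
    ContDiffAt ℝ ∞ (fun z => (F z).det) y := by
  simp only [Matrix.det_apply']
  exact contDiffAt_finset_sum fun s _ => contDiffAt_const.mul (contDiffAt_prod fun i _ => hF _ _)

/-- Jacobi's formula. -/
theorem fderiv_det {F : W → Matrix m m ℝ} {y : W} (hF : MatSmoothAt F y) (v : W) :
    fderiv ℝ (fun z => (F z).det) y v = ((F y).adjugate * dMat v F y).trace := by
  have h1 : ∀ s : Equiv.Perm m, fderiv ℝ (fun z => ∏ i, F z (s i) i) y v
      = ∑ i, (∏ j ∈ Finset.univ.erase i, F y (s j) j) * dMat v F y (s i) i := by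
    intro s
    rw [(HasFDerivAt.finsetProd (u := Finset.univ) (g := fun i z => F z (s i) i)
      fun i _ => (contDiffAt_differentiableAt (hF (s i) i)).hasFDerivAt).fderiv]
    simp [dMat_apply]
  -- Cramer's rule: the $i$-th diagonal entry is the determinant with column $i$ differentiated,
  -- which is one summand of the derivative of a determinant.
  have h2 : ∀ i, ((F y).adjugate * dMat v F y) i i
      = ((F y).updateCol i fun k => dMat v F y k i).det := by
    intro i
    rw [← Matrix.cramer_apply, Matrix.cramer_eq_adjugate_mulVec]
    rfl
  simp only [Matrix.trace, Matrix.diag_apply, h2]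
  simp only [Matrix.det_apply']
  rw [fderiv_sum_apply fun s _ => contDiffAt_const.mul (contDiffAt_prod fun i _ => hF _ _),
    Finset.sum_comm]
  refine Finset.sum_congr rfl fun s _ => ?_
  rw [fderiv_mul_apply contDiffAt_const (contDiffAt_prod fun i _ => hF _ _), h1,
    ← Finset.mul_sum]
  simp only [fderiv_fun_const, Pi.zero_apply, zero_apply, zero_mul, zero_add]
  congr 1
  refine Finset.sum_congr rfl fun i _ => ?_
  rw [← Finset.mul_prod_erase _ _ (Finset.mem_univ i), mul_comm]
  congr 1
  · simp
  · exact Finset.prod_congr rfl fun j hj => by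
      rw [Matrix.updateCol_ne (Finset.ne_of_mem_erase hj)]

/-- By Cramer's rule each entry of the inverse is a quotient of determinants of matrices with smooth
entries. -/
theorem MatSmoothAt.inv {F : W → Matrix m m ℝ} {y : W} (hF : MatSmoothAt F y)
    (h : (F y).det ≠ 0) : MatSmoothAt (fun z => (F z)⁻¹) y := by
  intro i j
  have : (fun z => (F z)⁻¹ i j) = fun z => (F z).det⁻¹ * ((F z).updateRow j (Pi.single i 1)).det := by
    funext z
    rw [Matrix.inv_def, Matrix.smul_apply, Matrix.adjugate_apply, Ring.inverse_eq_inv', smul_eq_mul]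
  rw [this]
  refine (hF.det.inv h).mul (MatSmoothAt.det (F := fun z => (F z).updateRow j (Pi.single i 1)) ?_)
  intro k l
  by_cases hk : k = j
  · subst hk
    simpa using contDiffAt_const
  · simpa [Matrix.updateRow_ne hk] using hF k l

theorem eventually_det_ne_zero {F : W → Matrix m m ℝ} {y : W} (hF : MatSmoothAt F y)
    (h : (F y).det ≠ 0) : ∀ᶠ z in 𝓝 y, (F z).det ≠ 0 :=
  hF.det.continuousAt.eventually_ne h

theorem dMat_inv {F : W → Matrix m m ℝ} {y : W} (hF : MatSmoothAt F y)
    (h : (F y).det ≠ 0) (v : W) :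
    dMat v (fun z => (F z)⁻¹) y = -((F y)⁻¹ * dMat v F y * (F y)⁻¹) := by
  -- The identity to differentiate holds only near `y`, where the determinant stays nonzero.
  have h1 : (fun z => (F z)⁻¹ * F z) =ᶠ[𝓝 y] fun _ => 1 :=
    (eventually_det_ne_zero hF h).mono fun z hz => Matrix.nonsing_inv_mul _ (isUnit_iff_ne_zero.2 hz)
  have h2 := dMat_congr h1 v
  rw [dMat_const, dMat_mul (hF.inv h) hF] at h2
  have h3 : dMat v (fun z => (F z)⁻¹) y * F y = -((F y)⁻¹ * dMat v F y) :=
    eq_neg_of_add_eq_zero_left h2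
  calc dMat v (fun z => (F z)⁻¹) y = dMat v (fun z => (F z)⁻¹) y * F y * (F y)⁻¹ :=
        (Matrix.mul_nonsing_inv_cancel_right _ _ (isUnit_iff_ne_zero.2 h)).symm
    _ = _ := by rw [h3, neg_mul]

theorem fderiv_det_eq_det_mul_trace {F : W → Matrix m m ℝ} {y : W} (hF : MatSmoothAt F y)
    (h : (F y).det ≠ 0) (v : W) :
    fderiv ℝ (fun z => (F z).det) y v = (F y).det * ((F y)⁻¹ * dMat v F y).trace := by
  rw [fderiv_det hF, Matrix.inv_def, Matrix.smul_mul, Matrix.trace_smul, Ring.inverse_eq_inv',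
    smul_eq_mul, mul_inv_cancel_left₀ h]

/-- The trace of the logarithmic derivative vanishes if the determinant is locally constant. -/
theorem trace_inv_mul_dMat_eq_zero {F : W → Matrix m m ℝ} {y : W} (hF : MatSmoothAt F y)
    (h : (F y).det ≠ 0) (hc : ∀ᶠ z in 𝓝 y, (F z).det = (F y).det) (v : W) :
    ((F y)⁻¹ * dMat v F y).trace = 0 := by
  have h1 := fderiv_det_eq_det_mul_trace hF h v
  have h2 : (fun z => (F z).det) =ᶠ[𝓝 y] fun _ => (F y).det := hc
  rw [h2.fderiv_eq] at h1
  simpa [h] using h1.symm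

theorem fderiv_sqrt_det {F : W → Matrix m m ℝ} {y : W} (hF : MatSmoothAt F y)
    (h : 0 < (F y).det) (v : W) :
    fderiv ℝ (fun z => Real.sqrt (F z).det) y v
      = (1 / 2) * Real.sqrt (F y).det * ((F y)⁻¹ * dMat v F y).trace := by
  rw [fderiv_sqrt (contDiffAt_differentiableAt hF.det) h.ne', smul_apply,
    fderiv_det_eq_det_mul_trace hF h.ne', smul_eq_mul]
  have hs : Real.sqrt (F y).det ≠ 0 := (Real.sqrt_pos.2 h).ne'
  field_simp
  rw [Real.sq_sqrt h.le]

theorem MatSmoothAt.sqrt_det {F : W → Matrix m m ℝ} {y : W} (hF : MatSmoothAt F y)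
    (h : 0 < (F y).det) : ContDiffAt ℝ ∞ (fun z => Real.sqrt (F z).det) y :=
  hF.det.sqrt h.ne'

end MatrixCalculus

/-! ### The Ricci tensor of a block metric -/

section BlockMetric

variable {W W' : Type*} [NormedAddCommGroup W] [NormedSpace ℝ W] [NormedAddCommGroup W']
  [NormedSpace ℝ W'] {ι κ : Type*}

/-- A smooth metric `g` and a smooth fibre metric `G` of locally constant determinant on an open
set `Ω`. -/
structure LocalData [Fintype ι] [Fintype κ] [DecidableEq κ] (Ω : Set W)
    (g : W → Matrix ι ι ℝ) (G : W → Matrix κ κ ℝ) : Prop where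
  isOpen : IsOpen Ω
  smooth_base : ∀ y ∈ Ω, MatSmoothAt g y
  posDef_base : ∀ y ∈ Ω, (g y).PosDef
  smooth_fiber : ∀ y ∈ Ω, MatSmoothAt G y
  posDef_fiber : ∀ y ∈ Ω, (G y).PosDef
  det_fiber : ∀ y ∈ Ω, ∀ᶠ z in 𝓝 y, (G z).det = (G y).det

/-- No differentiability is needed: if the composite is differentiable, so is `f`, by restriction to
a horizontal slice; otherwise both derivatives take the default value zero. This spares smoothness
checks for Christoffel symbols. -/
theorem fderiv_comp_fst (f : W → ℝ) (z : W × W') :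
    fderiv ℝ (fun q : W × W' => f q.1) z = (fderiv ℝ f z.1).comp (ContinuousLinearMap.fst ℝ W W') := by
  by_cases hf : DifferentiableAt ℝ f z.1
  · exact (hf.hasFDerivAt.comp z hasFDerivAt_fst).fderiv
  · rw [fderiv_zero_of_not_differentiableAt hf, fderiv_zero_of_not_differentiableAt]
    · simp
    · intro h
      apply hf
      have h2 : DifferentiableAt ℝ (fun y : W => (y, z.2)) z.1 := by fun_prop
      exact DifferentiableAt.comp (g := fun q : W × W' => f q.1) z.1 h h2

theorem pd_prod_inl (β : Module.Basis ι ℝ W) (γ : Module.Basis κ ℝ W') (a : ι) (f : W → ℝ)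
    (z : W × W') : pd (β.prod γ) (Sum.inl a) (fun q => f q.1) z = pd β a f z.1 := by
  simp [pd, fderiv_comp_fst]

theorem pd_prod_inr (β : Module.Basis ι ℝ W) (γ : Module.Basis κ ℝ W') (k : κ) (f : W → ℝ)
    (z : W × W') : pd (β.prod γ) (Sum.inr k) (fun q => f q.1) z = 0 := by
  simp [pd, fderiv_comp_fst]

theorem pd_congr {f f' : W → ℝ} {y : W} (h : f =ᶠ[𝓝 y] f') (β : Module.Basis ι ℝ W) (a : ι) :
    pd β a f y = pd β a f' y := by
  simp only [pd, h.fderiv_eq]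

variable [Fintype ι] [DecidableEq ι] [Fintype κ] [DecidableEq κ]

theorem christoffel_congr {g g' : W → Matrix ι ι ℝ} {y : W} (h : g =ᶠ[𝓝 y] g')
    (β : Module.Basis ι ℝ W) (k i j : ι) :
    christoffel β g k i j =ᶠ[𝓝 y] christoffel β g' k i j := by
  filter_upwards [h.eventually_nhds] with z hz
  have : ∀ a b c, pd β a (fun z => g z b c) z = pd β a (fun z => g' z b c) z := fun a b c =>
    pd_congr (hz.mono fun w hw => by simp only [hw]) β a
  simp only [christoffel, this, hz.self_of_nhds]

/-- Two derivatives of the metric occur, so equality of germs is required. This allows the chart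
components on the total space to be replaced by the block metric, with which they agree near the
point. -/
theorem ricci_congr {g g' : W → Matrix ι ι ℝ} {y : W} (h : g =ᶠ[𝓝 y] g')
    (β : Module.Basis ι ℝ W) : ricci β g y = ricci β g' y := by
  ext i j
  have h1 : ∀ k i j, christoffel β g k i j y = christoffel β g' k i j y :=
    fun k i j => (christoffel_congr h β k i j).self_of_nhds
  have h2 : ∀ a k i j, pd β a (christoffel β g k i j) y = pd β a (christoffel β g' k i j) y :=
    fun a k i j => pd_congr (christoffel_congr h β k i j) β a
  simp only [ricci, Matrix.of_apply, h1, h2]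

theorem lieDerivMetric_congr {g g' : W → Matrix ι ι ℝ} {V V' : W → ι → ℝ} {y : W}
    (h : g =ᶠ[𝓝 y] g') (hV : V =ᶠ[𝓝 y] V') (β : Module.Basis ι ℝ W) :
    lieDerivMetric β g V y = lieDerivMetric β g' V' y := by
  ext i j
  have h1 : ∀ a b c, pd β a (fun z => g z b c) y = pd β a (fun z => g' z b c) y := fun a b c =>
    pd_congr (h.mono fun w hw => by simp only [hw]) β a
  have h2 : ∀ a b, pd β a (fun z => V z b) y = pd β a (fun z => V' z b) y := fun a b =>
    pd_congr (hV.mono fun w hw => by simp only [hw]) β a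
  simp only [lieDerivMetric, Matrix.of_apply, h1, h2, h.self_of_nhds, hV.self_of_nhds]

/-- The metric `g_{αβ} dx^α dx^β + G_{ij} dx^i dx^j` on a product. -/
def blockMetric (W' : Type*) (g : W → Matrix ι ι ℝ) (G : W → Matrix κ κ ℝ) (z : W × W') :
    Matrix (ι ⊕ κ) (ι ⊕ κ) ℝ :=
  Matrix.fromBlocks (g z.1) 0 0 (G z.1)

theorem LocalData.base_symm {Ω : Set W} {g : W → Matrix ι ι ℝ} {G : W → Matrix κ κ ℝ}
    (hd : LocalData Ω g G) {y : W} (hy : y ∈ Ω) (a b : ι) : g y a b = g y b a :=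
  by simpa using ((hd.posDef_base y hy).isHermitian.apply b a)

theorem LocalData.fiber_symm {Ω : Set W} {g : W → Matrix ι ι ℝ} {G : W → Matrix κ κ ℝ}
    (hd : LocalData Ω g G) {y : W} (hy : y ∈ Ω) (a b : κ) : G y a b = G y b a :=
  by simpa using ((hd.posDef_fiber y hy).isHermitian.apply b a)

theorem LocalData.base_inv_symm {Ω : Set W} {g : W → Matrix ι ι ℝ} {G : W → Matrix κ κ ℝ}
    (hd : LocalData Ω g G) {y : W} (hy : y ∈ Ω) (a b : ι) : (g y)⁻¹ a b = (g y)⁻¹ b a :=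
  by simpa using ((hd.posDef_base y hy).isHermitian.inv.apply b a)

theorem LocalData.fiber_inv_symm {Ω : Set W} {g : W → Matrix ι ι ℝ} {G : W → Matrix κ κ ℝ}
    (hd : LocalData Ω g G) {y : W} (hy : y ∈ Ω) (a b : κ) : (G y)⁻¹ a b = (G y)⁻¹ b a :=
  by simpa using ((hd.posDef_fiber y hy).isHermitian.inv.apply b a)

theorem LocalData.pd_base_symm {Ω : Set W} {g : W → Matrix ι ι ℝ} {G : W → Matrix κ κ ℝ}
    (hd : LocalData Ω g G) {y : W} (hy : y ∈ Ω) (β : Module.Basis ι ℝ W) (c a b : ι) :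
    pd β c (fun z => g z a b) y = pd β c (fun z => g z b a) y :=
  pd_congr (Filter.eventually_of_mem (hd.isOpen.mem_nhds hy) fun _ hz => hd.base_symm hz a b) β c

theorem LocalData.pd_fiber_symm {Ω : Set W} {g : W → Matrix ι ι ℝ} {G : W → Matrix κ κ ℝ}
    (hd : LocalData Ω g G) {y : W} (hy : y ∈ Ω) (β : Module.Basis ι ℝ W) (c : ι) (a b : κ) :
    pd β c (fun z => G z a b) y = pd β c (fun z => G z b a) y :=
  pd_congr (Filter.eventually_of_mem (hd.isOpen.mem_nhds hy) fun _ hz => hd.fiber_symm hz a b) β c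

variable {Ω : Set W} {g : W → Matrix ι ι ℝ} {G : W → Matrix κ κ ℝ}

theorem LocalData.blockMetric_inv (hd : LocalData Ω g G) {z : W × W'} (hz : z.1 ∈ Ω) :
    (blockMetric W' g G z)⁻¹ = Matrix.fromBlocks (g z.1)⁻¹ 0 0 (G z.1)⁻¹ := by
  rw [blockMetric, Matrix.inv_fromBlocks_zero₂₁_of_isUnit_iff]
  · simp
  · exact iff_of_true (hd.posDef_base _ hz).isUnit (hd.posDef_fiber _ hz).isUnit

variable (β : Module.Basis ι ℝ W) (γ : Module.Basis κ ℝ W')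

theorem pd_blockMetric_inr (k : κ) (a b : ι ⊕ κ) (z : W × W') :
    pd (β.prod γ) (Sum.inr k) (fun q => blockMetric W' g G q a b) z = 0 :=
  pd_prod_inr β γ k (fun y => Matrix.fromBlocks (g y) 0 0 (G y) a b) z

theorem pd_blockMetric_inl (c : ι) (a b : ι ⊕ κ) (z : W × W') :
    pd (β.prod γ) (Sum.inl c) (fun q => blockMetric W' g G q a b) z
      = Matrix.fromBlocks (dMat (β c) g z.1) 0 0 (dMat (β c) G z.1) a b := by
  have := pd_prod_inl β γ c (fun y => Matrix.fromBlocks (g y) 0 0 (G y) a b) z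
  refine this.trans ?_
  rcases a with a | a <;> rcases b with b | b <;> simp [dMat, pd]

/-- The block metric is unchanged by the reflection of the fibre coordinates and its coefficients
depend on the base only. Hence the Christoffel symbols with an odd number of fibre indices vanish;
the others are those of the base, $\Gamma^c_{ij} = -\frac12 g^{cb}\partial_b G_{ij}$ and
$\Gamma^k_{aj} = \Gamma^k_{ja} = \frac12 (G^{-1}\partial_a G)^k{}_j$. -/
theorem LocalData.christoffel_block_lll (hd : LocalData Ω g G) {z : W × W'} (hz : z.1 ∈ Ω)
    (c a b : ι) :
    christoffel (β.prod γ) (blockMetric W' g G) (Sum.inl c) (Sum.inl a) (Sum.inl b) z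
      = christoffel β g c a b z.1 := by
  simp [christoffel, pd_blockMetric_inl, pd_blockMetric_inr, hd.blockMetric_inv hz]
  rfl

theorem LocalData.christoffel_block_llr (hd : LocalData Ω g G) {z : W × W'} (hz : z.1 ∈ Ω)
    (c a : ι) (j : κ) :
    christoffel (β.prod γ) (blockMetric W' g G) (Sum.inl c) (Sum.inl a) (Sum.inr j) z = 0 := by
  simp [christoffel, pd_blockMetric_inl, pd_blockMetric_inr, hd.blockMetric_inv hz]

theorem LocalData.christoffel_block_lrl (hd : LocalData Ω g G) {z : W × W'} (hz : z.1 ∈ Ω)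
    (c : ι) (i : κ) (b : ι) :
    christoffel (β.prod γ) (blockMetric W' g G) (Sum.inl c) (Sum.inr i) (Sum.inl b) z = 0 := by
  simp [christoffel, pd_blockMetric_inl, pd_blockMetric_inr, hd.blockMetric_inv hz]

theorem LocalData.christoffel_block_lrr (hd : LocalData Ω g G) {z : W × W'} (hz : z.1 ∈ Ω)
    (c : ι) (i j : κ) :
    christoffel (β.prod γ) (blockMetric W' g G) (Sum.inl c) (Sum.inr i) (Sum.inr j) z
      = -(1 / 2) * ∑ b, (g z.1)⁻¹ c b * dMat (β b) G z.1 i j := by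
  simp [christoffel, pd_blockMetric_inl, pd_blockMetric_inr, hd.blockMetric_inv hz]

theorem LocalData.christoffel_block_rll (hd : LocalData Ω g G) {z : W × W'} (hz : z.1 ∈ Ω)
    (k : κ) (a b : ι) :
    christoffel (β.prod γ) (blockMetric W' g G) (Sum.inr k) (Sum.inl a) (Sum.inl b) z = 0 := by
  simp [christoffel, pd_blockMetric_inl, pd_blockMetric_inr, hd.blockMetric_inv hz]

theorem LocalData.christoffel_block_rlr (hd : LocalData Ω g G) {z : W × W'} (hz : z.1 ∈ Ω)
    (k : κ) (a : ι) (j : κ) :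
    christoffel (β.prod γ) (blockMetric W' g G) (Sum.inr k) (Sum.inl a) (Sum.inr j) z
      = (1 / 2) * ((G z.1)⁻¹ * dMat (β a) G z.1) k j := by
  have : ∀ l, dMat (β a) G z.1 j l = dMat (β a) G z.1 l j :=
    fun l => hd.pd_fiber_symm hz β a j l
  simp [christoffel, pd_blockMetric_inl, pd_blockMetric_inr, hd.blockMetric_inv hz,
    Matrix.mul_apply, this]

theorem LocalData.christoffel_block_rrl (hd : LocalData Ω g G) {z : W × W'} (hz : z.1 ∈ Ω)
    (k i : κ) (a : ι) :
    christoffel (β.prod γ) (blockMetric W' g G) (Sum.inr k) (Sum.inr i) (Sum.inl a) z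
      = (1 / 2) * ((G z.1)⁻¹ * dMat (β a) G z.1) k i := by
  have : ∀ l, dMat (β a) G z.1 i l = dMat (β a) G z.1 l i :=
    fun l => hd.pd_fiber_symm hz β a i l
  simp [christoffel, pd_blockMetric_inl, pd_blockMetric_inr, hd.blockMetric_inv hz,
    Matrix.mul_apply, this]

theorem LocalData.christoffel_block_rrr (hd : LocalData Ω g G) {z : W × W'} (hz : z.1 ∈ Ω)
    (k i j : κ) :
    christoffel (β.prod γ) (blockMetric W' g G) (Sum.inr k) (Sum.inr i) (Sum.inr j) z = 0 := by
  simp [christoffel, pd_blockMetric_inl, pd_blockMetric_inr, hd.blockMetric_inv hz]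

/-- A function on the product which depends on the base point only, near the fibre over `Ω`,
is differentiated accordingly. -/
theorem LocalData.pd_inl_of_eq (hd : LocalData Ω g G) {f : W × W' → ℝ} {f' : W → ℝ}
    (h : ∀ q : W × W', q.1 ∈ Ω → f q = f' q.1) {z : W × W'} (hz : z.1 ∈ Ω) (a : ι) :
    pd (β.prod γ) (Sum.inl a) f z = pd β a f' z.1 := by
  rw [← pd_prod_inl β γ a f' z]
  refine pd_congr ?_ _ _
  exact Filter.eventually_of_mem ((hd.isOpen.preimage continuous_fst).mem_nhds hz) h

theorem LocalData.pd_inr_of_eq (hd : LocalData Ω g G) {f : W × W' → ℝ} {f' : W → ℝ}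
    (h : ∀ q : W × W', q.1 ∈ Ω → f q = f' q.1) {z : W × W'} (hz : z.1 ∈ Ω) (k : κ) :
    pd (β.prod γ) (Sum.inr k) f z = 0 := by
  rw [← pd_prod_inr β γ k f' z]
  refine pd_congr ?_ _ _
  exact Filter.eventually_of_mem ((hd.isOpen.preimage continuous_fst).mem_nhds hz) h

theorem LocalData.trace_inv_mul_dMat (hd : LocalData Ω g G) {y : W} (hy : y ∈ Ω) (v : W) :
    ((G y)⁻¹ * dMat v G y).trace = 0 :=
  trace_inv_mul_dMat_eq_zero (hd.smooth_fiber y hy) (hd.posDef_fiber y hy).det_pos.ne'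
    (hd.det_fiber y hy) v

/-- Summing over fibre indices adds to the base Ricci tensor two trace terms,
$\partial_b\Gamma^k_{ak}$ and $\Gamma^k_{kc}\Gamma^c_{ab}$, which vanish by volume preservation, and
the product $-\Gamma^k_{bl}\Gamma^l_{ak}$, which is the term with $\frac14$. -/
theorem LocalData.ricci_block_ll (hd : LocalData Ω g G) {z : W × W'} (hz : z.1 ∈ Ω) (a b : ι) :
    ricci (β.prod γ) (blockMetric W' g G) z (Sum.inl a) (Sum.inl b)
      = ricci β g z.1 a b - (1 / 4) * ((G z.1)⁻¹ * dMat (β a) G z.1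
          * (G z.1)⁻¹ * dMat (β b) G z.1).trace := by
  have e1 : ∀ c d e f : ι, pd (β.prod γ) (Sum.inl f)
      (christoffel (β.prod γ) (blockMetric W' g G) (Sum.inl c) (Sum.inl d) (Sum.inl e)) z
        = pd β f (christoffel β g c d e) z.1 := fun c d e f =>
    hd.pd_inl_of_eq β γ (fun q hq => hd.christoffel_block_lll β γ hq c d e) hz f
  have e2 : ∀ k : κ, pd (β.prod γ) (Sum.inr k)
      (christoffel (β.prod γ) (blockMetric W' g G) (Sum.inr k) (Sum.inl a) (Sum.inl b)) z = 0 :=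
    fun k => hd.pd_inr_of_eq β γ (f' := fun _ => 0)
      (fun q hq => hd.christoffel_block_rll β γ hq k a b) hz k
  have e3 : ∑ k : κ, pd (β.prod γ) (Sum.inl b)
      (christoffel (β.prod γ) (blockMetric W' g G) (Sum.inr k) (Sum.inl a) (Sum.inr k)) z = 0 := by
    have h1 : ∀ k : κ, pd (β.prod γ) (Sum.inl b)
      (christoffel (β.prod γ) (blockMetric W' g G) (Sum.inr k) (Sum.inl a) (Sum.inr k)) z
        = fderiv ℝ (fun y => (1 / 2) * ((G y)⁻¹ * dMat (β a) G y) k k) z.1 (β b) := fun k =>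
      hd.pd_inl_of_eq β γ (fun q hq => hd.christoffel_block_rlr β γ hq k a k) hz b
    have hs : MatSmoothAt (fun y => (G y)⁻¹ * dMat (β a) G y) z.1 :=
      ((hd.smooth_fiber _ hz).inv (hd.posDef_fiber _ hz).det_pos.ne').mul
        ((hd.smooth_fiber _ hz).dMat _)
    -- Only the trace vanishes, not its individual summands, so the sum has to be taken before
    -- differentiating.
    rw [Finset.sum_congr rfl fun k _ => h1 k,
      ← fderiv_sum_apply fun k _ => contDiffAt_const.mul (hs k k)]
    have h2 : (fun y => ∑ k, (1 / 2 : ℝ) * ((G y)⁻¹ * dMat (β a) G y) k k) =ᶠ[𝓝 z.1] fun _ => 0 :=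
      Filter.eventually_of_mem (hd.isOpen.mem_nhds hz) fun y hy => by
        have := hd.trace_inv_mul_dMat hy (β a)
        simp only [Matrix.trace, Matrix.diag_apply] at this
        simp only [← Finset.mul_sum, this, mul_zero]
    rw [h2.fderiv_eq]
    simp
  have e5 : ∀ c, ∑ k : κ, ((G z.1)⁻¹ * dMat (β c) G z.1) k k = 0 :=
    fun c => hd.trace_inv_mul_dMat hz (β c)
  have e6 : ∀ c d, (∑ k : κ, (1 / 2) * ((G z.1)⁻¹ * dMat (β c) G z.1) k k * d) = 0 := by
    intro c d
    rw [← Finset.sum_mul, ← Finset.mul_sum, e5]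
    simp
  simp only [ricci, Matrix.of_apply, Fintype.sum_sum_type, e1, e2, e3,
    hd.christoffel_block_lll β γ hz, hd.christoffel_block_rll β γ hz,
    hd.christoffel_block_llr β γ hz, hd.christoffel_block_rlr β γ hz,
    hd.christoffel_block_rrl β γ hz, hd.christoffel_block_rrr β γ hz,
    Finset.sum_add_distrib, mul_zero, zero_mul, Finset.sum_const_zero, add_zero, zero_add]
  rw [Finset.sum_comm (s := (Finset.univ : Finset κ)) (t := (Finset.univ : Finset ι))]
  simp only [e6, Finset.sum_const_zero, add_zero]
  have e7 : (∑ k : κ, ∑ l : κ, 1 / 2 * ((G z.1)⁻¹ * dMat (β b) G z.1) k l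
      * (1 / 2 * ((G z.1)⁻¹ * dMat (β a) G z.1) l k))
      = (1 / 4) * ((G z.1)⁻¹ * dMat (β a) G z.1 * (G z.1)⁻¹ * dMat (β b) G z.1).trace := by
    rw [Matrix.mul_assoc, Matrix.trace_mul_comm]
    simp only [Matrix.trace, Matrix.diag_apply, Finset.mul_sum]
    refine Finset.sum_congr rfl fun k _ => ?_
    rw [Matrix.mul_apply, Finset.mul_sum]
    refine Finset.sum_congr rfl fun l _ => ?_
    ring
  rw [e7]
  ring

/-- In each product of Christoffel symbols one factor has an odd number of fibre indices; the
derivative terms are either derivatives of such a symbol or derivatives along the fibre, and vanish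
as well. -/
theorem LocalData.ricci_block_lr (hd : LocalData Ω g G) {z : W × W'} (hz : z.1 ∈ Ω) (a : ι)
    (j : κ) : ricci (β.prod γ) (blockMetric W' g G) z (Sum.inl a) (Sum.inr j) = 0 := by
  have e1 : ∀ c d : ι, pd (β.prod γ) (Sum.inl d)
      (christoffel (β.prod γ) (blockMetric W' g G) (Sum.inl c) (Sum.inl a) (Sum.inr j)) z = 0 := by
    intro c d
    rw [hd.pd_inl_of_eq β γ (f' := fun _ => 0) (fun q hq => hd.christoffel_block_llr β γ hq c a j) hz]
    simp [pd]
  have e2 : ∀ k l : κ, pd (β.prod γ) (Sum.inr l)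
      (christoffel (β.prod γ) (blockMetric W' g G) (Sum.inr k) (Sum.inl a) (Sum.inr j)) z = 0 :=
    fun k l => hd.pd_inr_of_eq β γ
      (f' := fun y => (1 / 2) * ((G y)⁻¹ * dMat (β a) G y) k j)
      (fun q hq => hd.christoffel_block_rlr β γ hq k a j) hz l
  have e3 : ∀ k l : κ, pd (β.prod γ) (Sum.inr l)
      (christoffel (β.prod γ) (blockMetric W' g G) (Sum.inr k) (Sum.inl a) (Sum.inr k)) z = 0 :=
    fun k l => hd.pd_inr_of_eq β γ
      (f' := fun y => (1 / 2) * ((G y)⁻¹ * dMat (β a) G y) k k)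
      (fun q hq => hd.christoffel_block_rlr β γ hq k a k) hz l
  have e4 : ∀ c : ι, ∀ l : κ, pd (β.prod γ) (Sum.inr l)
      (christoffel (β.prod γ) (blockMetric W' g G) (Sum.inl c) (Sum.inl a) (Sum.inl c)) z = 0 :=
    fun c l => hd.pd_inr_of_eq β γ
      (f' := christoffel β g c a c)
      (fun q hq => hd.christoffel_block_lll β γ hq c a c) hz l
  simp [ricci, e1, e2, e3, e4,
    hd.christoffel_block_lll β γ hz, hd.christoffel_block_rll β γ hz,
    hd.christoffel_block_llr β γ hz, hd.christoffel_block_lrl β γ hz,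
    hd.christoffel_block_rrr β γ hz]

/-- The same parity argument; it is repeated because the coordinate formula in `ricci` is not
visibly symmetric. -/
theorem LocalData.ricci_block_rl (hd : LocalData Ω g G) {z : W × W'} (hz : z.1 ∈ Ω) (a : ι)
    (j : κ) : ricci (β.prod γ) (blockMetric W' g G) z (Sum.inr j) (Sum.inl a) = 0 := by
  have e1 : ∀ c d : ι, pd (β.prod γ) (Sum.inl d)
      (christoffel (β.prod γ) (blockMetric W' g G) (Sum.inl c) (Sum.inr j) (Sum.inl a)) z = 0 := by
    intro c d
    rw [hd.pd_inl_of_eq β γ (f' := fun _ => 0) (fun q hq => hd.christoffel_block_lrl β γ hq c j a) hz]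
    simp [pd]
  have e2 : ∀ k l : κ, pd (β.prod γ) (Sum.inr l)
      (christoffel (β.prod γ) (blockMetric W' g G) (Sum.inr k) (Sum.inr j) (Sum.inl a)) z = 0 :=
    fun k l => hd.pd_inr_of_eq β γ
      (f' := fun y => (1 / 2) * ((G y)⁻¹ * dMat (β a) G y) k j)
      (fun q hq => hd.christoffel_block_rrl β γ hq k j a) hz l
  have e3 : ∀ k : κ, pd (β.prod γ) (Sum.inl a)
      (christoffel (β.prod γ) (blockMetric W' g G) (Sum.inr k) (Sum.inr j) (Sum.inr k)) z = 0 := by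
    intro k
    rw [hd.pd_inl_of_eq β γ (f' := fun _ => 0) (fun q hq => hd.christoffel_block_rrr β γ hq k j k) hz]
    simp [pd]
  have e4 : ∀ c : ι, pd (β.prod γ) (Sum.inl a)
      (christoffel (β.prod γ) (blockMetric W' g G) (Sum.inl c) (Sum.inr j) (Sum.inl c)) z = 0 := by
    intro c
    rw [hd.pd_inl_of_eq β γ (f' := fun _ => 0) (fun q hq => hd.christoffel_block_lrl β γ hq c j c) hz]
    simp [pd]
  simp [ricci, e1, e2, e3, e4,
    hd.christoffel_block_lll β γ hz, hd.christoffel_block_rll β γ hz,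
    hd.christoffel_block_llr β γ hz, hd.christoffel_block_lrl β γ hz,
    hd.christoffel_block_rrr β γ hz]

/-- The contraction `g^{cb} ∂_b G`. -/
noncomputable def gradient (β : Module.Basis ι ℝ W) (g : W → Matrix ι ι ℝ) (G : W → Matrix κ κ ℝ)
    (c : ι) (y : W) : Matrix κ κ ℝ :=
  ∑ b, (g y)⁻¹ c b • dMat (β b) G y

/-- The divergence `∂_a (√(det g) g^{ab} G⁻¹ ∂_b G)`, the Euler-Lagrange expression of the energy
of maps into the positive-definite symmetric matrices. -/
noncomputable def eulerLagrange (β : Module.Basis ι ℝ W) (g : W → Matrix ι ι ℝ)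
    (G : W → Matrix κ κ ℝ) (y : W) : Matrix κ κ ℝ :=
  ∑ a, dMat (β a) (fun z => Real.sqrt (g z).det • ((G z)⁻¹ * gradient β g G a z)) y

theorem LocalData.matSmoothAt_base_inv (hd : LocalData Ω g G) {y : W} (hy : y ∈ Ω) :
    MatSmoothAt (fun z => (g z)⁻¹) y :=
  (hd.smooth_base y hy).inv (hd.posDef_base y hy).det_pos.ne'

theorem LocalData.matSmoothAt_fiber_inv (hd : LocalData Ω g G) {y : W} (hy : y ∈ Ω) :
    MatSmoothAt (fun z => (G z)⁻¹) y :=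
  (hd.smooth_fiber y hy).inv (hd.posDef_fiber y hy).det_pos.ne'

theorem LocalData.contDiffAt_sqrt_det (hd : LocalData Ω g G) {y : W} (hy : y ∈ Ω) :
    ContDiffAt ℝ ∞ (fun z => Real.sqrt (g z).det) y :=
  (hd.smooth_base y hy).sqrt_det (hd.posDef_base y hy).det_pos

theorem LocalData.matSmoothAt_gradient (hd : LocalData Ω g G) {y : W} (hy : y ∈ Ω) (c : ι) :
    MatSmoothAt (gradient β g G c) y :=
  MatSmoothAt.sum fun b _ => MatSmoothAt.smul (hd.matSmoothAt_base_inv hy c b)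
    ((hd.smooth_fiber y hy).dMat (β b))

theorem LocalData.fiber_mul_inv (hd : LocalData Ω g G) {y : W} (hy : y ∈ Ω) :
    G y * (G y)⁻¹ = 1 :=
  Matrix.mul_nonsing_inv _ (isUnit_iff_ne_zero.2 (hd.posDef_fiber y hy).det_pos.ne')

/-- The product rule: differentiating $\sqrt{\det g}$ gives the trace term and differentiating
$G^{-1}$ the quadratic term. This is the form in which the vertical Ricci block appears. -/
theorem LocalData.fiber_mul_eulerLagrange (hd : LocalData Ω g G) {y : W} (hy : y ∈ Ω) :
    G y * eulerLagrange β g G y = Real.sqrt (g y).det • ∑ a,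
      (dMat (β a) (gradient β g G a) y
        + ((1 / 2) * ((g y)⁻¹ * dMat (β a) g y).trace) • gradient β g G a y
        - dMat (β a) G y * (G y)⁻¹ * gradient β g G a y) := by
  rw [eulerLagrange, Finset.mul_sum, Finset.smul_sum]
  refine Finset.sum_congr rfl fun a _ => ?_
  have hg := hd.matSmoothAt_gradient β hy a
  have hi := hd.matSmoothAt_fiber_inv hy
  rw [dMat_smul (hd.contDiffAt_sqrt_det hy) (hi.mul hg), dMat_mul hi hg,
    dMat_inv (hd.smooth_fiber y hy) (hd.posDef_fiber y hy).det_pos.ne',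
    fderiv_sqrt_det (hd.smooth_base y hy) (hd.posDef_base y hy).det_pos]
  have e1 : ∀ X : Matrix κ κ ℝ, G y * ((G y)⁻¹ * X) = X := fun X => by
    rw [← Matrix.mul_assoc, hd.fiber_mul_inv hy, Matrix.one_mul]
  simp only [Matrix.mul_add, Matrix.mul_smul, Matrix.neg_mul, Matrix.mul_neg, Matrix.mul_assoc, e1,
    smul_add, smul_sub, smul_smul, smul_neg]
  module

/-- Of the three derivatives in the contracted symbol, two cancel because $g^{dl}$ is symmetric. The
result matches the logarithmic derivative of $\sqrt{\det g}$. -/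
theorem LocalData.christoffel_trace (hd : LocalData Ω g G) {y : W} (hy : y ∈ Ω) (c : ι) :
    ∑ d, christoffel β g d d c y = (1 / 2) * ((g y)⁻¹ * dMat (β c) g y).trace := by
  simp only [christoffel, ← Finset.mul_sum]
  congr 1
  simp only [Matrix.trace, Matrix.diag_apply, Matrix.mul_apply]
  have h1 : ∑ d, ∑ l, (g y)⁻¹ d l * pd β d (fun z => g z c l) y
      = ∑ d, ∑ l, (g y)⁻¹ d l * pd β l (fun z => g z d c) y := by
    rw [Finset.sum_comm]
    refine Finset.sum_congr rfl fun d _ => Finset.sum_congr rfl fun l _ => ?_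
    rw [hd.base_inv_symm hy, hd.pd_base_symm hy]
  simp only [mul_sub, mul_add, Finset.sum_sub_distrib, Finset.sum_add_distrib, h1]
  rw [add_sub_cancel_left]
  refine Finset.sum_congr rfl fun d _ => Finset.sum_congr rfl fun l _ => ?_
  rw [hd.pd_base_symm hy]
  rfl

theorem LocalData.sum_gradient_mul (hd : LocalData Ω g G) {y : W} (hy : y ∈ Ω) :
    ∑ c, gradient β g G c y * ((G y)⁻¹ * dMat (β c) G y)
      = ∑ a, dMat (β a) G y * (G y)⁻¹ * gradient β g G a y := by
  simp only [gradient, Finset.sum_mul, Finset.mul_sum, Matrix.smul_mul, Matrix.mul_smul]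
  rw [Finset.sum_comm]
  refine Finset.sum_congr rfl fun d _ => Finset.sum_congr rfl fun l _ => ?_
  rw [hd.base_inv_symm hy, Matrix.mul_assoc]

/-- Transposition reverses a product of symmetric matrices, and the symmetry of $g^{ab}$ allows the
raised index to move from one factor to the other. -/
theorem LocalData.sum_mul_gradient_symm (hd : LocalData Ω g G) {y : W} (hy : y ∈ Ω) (i j : κ) :
    (∑ a, dMat (β a) G y * (G y)⁻¹ * gradient β g G a y) j i
      = (∑ a, dMat (β a) G y * (G y)⁻¹ * gradient β g G a y) i j := by
  have h1 : (G y)⁻¹.transpose = (G y)⁻¹ := by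
    ext i j
    exact hd.fiber_inv_symm hy j i
  have h2 : ∀ a, (dMat (β a) G y).transpose = dMat (β a) G y := by
    intro a
    ext i j
    exact hd.pd_fiber_symm hy β a j i
  have h3 : ∀ a, (gradient β g G a y).transpose = gradient β g G a y := by
    intro a
    simp only [gradient, Matrix.transpose_sum, Matrix.transpose_smul, h2]
  rw [← Matrix.transpose_apply (∑ a, dMat (β a) G y * (G y)⁻¹ * gradient β g G a y) i j]
  simp only [Matrix.transpose_sum, Matrix.transpose_mul, h1, h2, h3]
  rw [hd.sum_gradient_mul β hy]

/-- The terms $\partial_c\Gamma^c_{ij}$ and $\Gamma^d_{dc}\Gamma^c_{ij}$ make up the divergence of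
$\nabla G$. The two mixed products, with one summation index in the base and one in the fibre, each
give $\frac14$ of the quadratic term. The factor $\sqrt{\det g}$ turns the sum into a coordinate
divergence. -/
theorem LocalData.ricci_block_rr (hd : LocalData Ω g G) {z : W × W'} (hz : z.1 ∈ Ω) (i j : κ) :
    Real.sqrt (g z.1).det * ricci (β.prod γ) (blockMetric W' g G) z (Sum.inr i) (Sum.inr j)
      = -(1 / 2) * (G z.1 * eulerLagrange β g G z.1) i j := by
  have e0 : ∀ q : W × W', q.1 ∈ Ω → ∀ c i j, christoffel (β.prod γ) (blockMetric W' g G)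
      (Sum.inl c) (Sum.inr i) (Sum.inr j) q = -(1 / 2) * gradient β g G c q.1 i j := by
    intro q hq c i j
    rw [hd.christoffel_block_lrr β γ hq, gradient, Matrix.sum_apply]
    rfl
  have e1 : ∀ c : ι, pd (β.prod γ) (Sum.inl c)
      (christoffel (β.prod γ) (blockMetric W' g G) (Sum.inl c) (Sum.inr i) (Sum.inr j)) z
        = -(1 / 2) * dMat (β c) (gradient β g G c) z.1 i j := by
    intro c
    rw [hd.pd_inl_of_eq β γ (f' := fun y => -(1 / 2) * gradient β g G c y i j)
      (fun q hq => e0 q hq c i j) hz, pd,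
      fderiv_mul_apply contDiffAt_const (hd.matSmoothAt_gradient β hz c i j)]
    simp [dMat]
  have e2 : ∀ k : κ, pd (β.prod γ) (Sum.inr k)
      (christoffel (β.prod γ) (blockMetric W' g G) (Sum.inr k) (Sum.inr i) (Sum.inr j)) z = 0 :=
    fun k => hd.pd_inr_of_eq β γ (f' := fun _ => 0)
      (fun q hq => hd.christoffel_block_rrr β γ hq k i j) hz k
  have e3 : ∀ k : κ, pd (β.prod γ) (Sum.inr j)
      (christoffel (β.prod γ) (blockMetric W' g G) (Sum.inr k) (Sum.inr i) (Sum.inr k)) z = 0 :=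
    fun k => hd.pd_inr_of_eq β γ (f' := fun _ => 0)
      (fun q hq => hd.christoffel_block_rrr β γ hq k i k) hz j
  have e4 : ∀ c : ι, pd (β.prod γ) (Sum.inr j)
      (christoffel (β.prod γ) (blockMetric W' g G) (Sum.inl c) (Sum.inr i) (Sum.inl c)) z = 0 :=
    fun c => hd.pd_inr_of_eq β γ (f' := fun _ => 0)
      (fun q hq => hd.christoffel_block_lrl β γ hq c i c) hz j
  have e5 : ∀ c, ∑ k : κ, ((G z.1)⁻¹ * dMat (β c) G z.1) k k = 0 :=
    fun c => hd.trace_inv_mul_dMat hz (β c)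
  have e6 : ∀ c d, (∑ k : κ, (1 / 2) * ((G z.1)⁻¹ * dMat (β c) G z.1) k k * d) = 0 := by
    intro c d
    rw [← Finset.sum_mul, ← Finset.mul_sum, e5]
    simp
  have e7 : ∑ c : ι, ∑ l : κ, -(1 / 2) * gradient β g G c z.1 j l
      * (1 / 2 * ((G z.1)⁻¹ * dMat (β c) G z.1) l i)
      = -(1 / 4) * (∑ a, dMat (β a) G z.1 * (G z.1)⁻¹ * gradient β g G a z.1) i j := by
    rw [← hd.sum_mul_gradient_symm β hz, ← hd.sum_gradient_mul β hz, Matrix.sum_apply,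
      Finset.mul_sum]
    refine Finset.sum_congr rfl fun c _ => ?_
    rw [Matrix.mul_apply, Finset.mul_sum]
    exact Finset.sum_congr rfl fun l _ => by ring
  have e8 : ∑ k : κ, ∑ c : ι, 1 / 2 * ((G z.1)⁻¹ * dMat (β c) G z.1) k j
      * (-(1 / 2) * gradient β g G c z.1 i k)
      = -(1 / 4) * (∑ a, dMat (β a) G z.1 * (G z.1)⁻¹ * gradient β g G a z.1) i j := by
    rw [← hd.sum_gradient_mul β hz, Matrix.sum_apply, Finset.mul_sum, Finset.sum_comm]
    refine Finset.sum_congr rfl fun c _ => ?_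
    rw [Matrix.mul_apply, Finset.mul_sum]
    exact Finset.sum_congr rfl fun l _ => by ring
  have e9 : ∑ d : ι, ∑ c : ι, christoffel β g d d c z.1 * (-(1 / 2) * gradient β g G c z.1 i j)
      = -(1 / 2) * ∑ c, ((1 / 2) * ((g z.1)⁻¹ * dMat (β c) g z.1).trace)
        * gradient β g G c z.1 i j := by
    rw [Finset.sum_comm, Finset.mul_sum]
    refine Finset.sum_congr rfl fun c _ => ?_
    rw [← Finset.sum_mul, hd.christoffel_trace β hz]
    ring
  have key : ricci (β.prod γ) (blockMetric W' g G) z (Sum.inr i) (Sum.inr j)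
      = -(1 / 2) * (∑ c, dMat (β c) (gradient β g G c) z.1 i j)
        + -(1 / 2) * (∑ c, ((1 / 2) * ((g z.1)⁻¹ * dMat (β c) g z.1).trace)
          * gradient β g G c z.1 i j)
        + (1 / 2) * (∑ a, dMat (β a) G z.1 * (G z.1)⁻¹ * gradient β g G a z.1) i j := by
    simp only [ricci, Matrix.of_apply, Fintype.sum_sum_type, e1, e2, e3, e4, e0 z hz,
      hd.christoffel_block_lll β γ hz, hd.christoffel_block_llr β γ hz,
      hd.christoffel_block_lrl β γ hz,
      hd.christoffel_block_rrl β γ hz, hd.christoffel_block_rrr β γ hz,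
      Finset.sum_add_distrib, mul_zero, zero_mul, Finset.sum_const_zero, add_zero, zero_add]
    rw [Finset.sum_comm (s := (Finset.univ : Finset κ)) (t := (Finset.univ : Finset ι))
      (f := fun k c => 1 / 2 * ((G z.1)⁻¹ * dMat (β c) G z.1) k k
        * (-(1 / 2) * gradient β g G c z.1 i j))]
    simp only [e6, e7, e8, e9, Finset.sum_const_zero, add_zero, ← Finset.mul_sum]
    ring
  rw [key, hd.fiber_mul_eulerLagrange β hz]
  simp only [Matrix.smul_apply, Matrix.sum_apply, Matrix.add_apply, Matrix.sub_apply,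
    Finset.sum_add_distrib, Finset.sum_sub_distrib, smul_eq_mul]
  ring

theorem LocalData.ricci_block_rr_eq_zero_iff (hd : LocalData Ω g G) {z : W × W'} (hz : z.1 ∈ Ω) :
    (∀ i j, ricci (β.prod γ) (blockMetric W' g G) z (Sum.inr i) (Sum.inr j) = 0)
      ↔ eulerLagrange β g G z.1 = 0 := by
  have hs : Real.sqrt (g z.1).det ≠ 0 := (Real.sqrt_pos.2 (hd.posDef_base _ hz).det_pos).ne'
  constructor
  · intro h
    have h1 : G z.1 * eulerLagrange β g G z.1 = 0 := by
      ext i j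
      have := hd.ricci_block_rr β γ hz i j
      rw [h, mul_zero] at this
      simpa using this.symm
    have h2 : (G z.1)⁻¹ * (G z.1 * eulerLagrange β g G z.1) = eulerLagrange β g G z.1 :=
      Matrix.nonsing_inv_mul_cancel_left _ _
        (isUnit_iff_ne_zero.2 (hd.posDef_fiber _ hz).det_pos.ne')
    rw [← h2, h1, Matrix.mul_zero]
  · intro h i j
    have := hd.ricci_block_rr β γ hz i j
    rw [h, Matrix.mul_zero] at this
    simpa [hs] using this

/-- The Lie derivative of the block metric along the multiple `c x^i ∂/∂x^i` of the radial field. -/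
theorem lieDerivMetric_blockMetric (c : ℝ) (z : W × W') :
    lieDerivMetric (β.prod γ) (blockMetric W' g G)
        (fun q k => (β.prod γ).repr (0, c • q.2) k) z
      = Matrix.fromBlocks 0 0 0 ((2 * c) • G z.1) := by
  have : FiniteDimensional ℝ W' := γ.finiteDimensional_of_finite
  have e1 : ∀ k l, pd (β.prod γ) k (fun q : W × W' => (β.prod γ).repr (0, c • q.2) (Sum.inl l)) z
      = 0 := by
    intro k l
    simp [pd]
  have e2 : ∀ k l, pd (β.prod γ) k (fun q : W × W' => (β.prod γ).repr (0, c • q.2) (Sum.inr l)) z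
      = c * γ.repr ((β.prod γ) k).2 l := by
    intro k l
    have h : HasFDerivAt (fun q : W × W' => (β.prod γ).repr (0, c • q.2) (Sum.inr l))
        (c • ((γ.coord l).toContinuousLinearMap.comp (ContinuousLinearMap.snd ℝ W W'))) z := by
      convert! (c • ((γ.coord l).toContinuousLinearMap.comp
        (ContinuousLinearMap.snd ℝ W W'))).hasFDerivAt using 1
      ext q
      simp
    rw [pd, h.fderiv]
    simp
  ext a b
  rw [lieDerivMetric, Matrix.of_apply]
  -- The transport term $V^k\partial_k$ drops out, since $V$ is vertical and the metric is constant
  -- along fibres. Each of the other two terms contributes $cG$ on the fibre block.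
  simp only [Fintype.sum_sum_type, e1, e2, pd_blockMetric_inr]
  rcases a with a | a <;> rcases b with b | b <;>
    simp [Finsupp.single_apply, blockMetric, Matrix.fromBlocks, two_mul, add_mul, Finset.sum_add_distrib,
      mul_comm c]

theorem LocalData.soliton_block_iff (hd : LocalData Ω g G) {z : W × W'} (hz : z.1 ∈ Ω) (t : ℝ) :
    ricci (β.prod γ) (blockMetric W' g G) z
        + (1 / 2 : ℝ) • lieDerivMetric (β.prod γ) (blockMetric W' g G)
          (fun q k => (β.prod γ).repr (0, (-(1 / (2 * t))) • q.2) k) z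
        + (1 / (2 * t)) • blockMetric W' g G z = 0
      ↔ eulerLagrange β g G z.1 = 0 ∧ ∀ a b, ricci β g z.1 a b
        - (1 / 4) * ((G z.1)⁻¹ * dMat (β a) G z.1 * (G z.1)⁻¹ * dMat (β b) G z.1).trace
        + (1 / (2 * t)) * g z.1 a b = 0 := by
  rw [lieDerivMetric_blockMetric, ← hd.ricci_block_rr_eq_zero_iff β γ hz, ← Matrix.ext_iff]
  -- On the fibre block the Lie derivative term is $-\frac{1}{2t}G$ and cancels the expansion term
  -- exactly.
  have key : ∀ p q, (ricci (β.prod γ) (blockMetric W' g G) z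
      + (1 / 2 : ℝ) • Matrix.fromBlocks 0 0 0 ((2 * -(1 / (2 * t))) • G z.1)
      + (1 / (2 * t)) • blockMetric W' g G z : Matrix (ι ⊕ κ) (ι ⊕ κ) ℝ) p q
      = ricci (β.prod γ) (blockMetric W' g G) z p q
        + Matrix.fromBlocks ((1 / (2 * t)) • g z.1) 0 0 0 p q := by
    rintro (a | a) (b | b) <;> simp [blockMetric]
    ring
  simp only [key]
  constructor
  · intro h
    refine ⟨fun i j => by simpa using h (Sum.inr i) (Sum.inr j), fun a b => ?_⟩
    rw [← hd.ricci_block_ll β γ hz]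
    simpa using h (Sum.inl a) (Sum.inl b)
  · rintro ⟨h1, h2⟩ (a | a) (b | b)
    · rw [hd.ricci_block_ll β γ hz]
      simpa using h2 a b
    · simp [hd.ricci_block_lr β γ hz]
    · simp [hd.ricci_block_rl β γ hz]
    · simp [h1]

end BlockMetric

/-! ### The first variation of the energy -/

section FirstVariation

variable {W : Type*} [NormedAddCommGroup W] [NormedSpace ℝ W] {ι κ : Type*} [Fintype ι]
  [DecidableEq ι] [Fintype κ] [DecidableEq κ]

theorem fderiv_prodMk_right_apply (s : ℝ) (y v : W) :
    fderiv ℝ (fun z : W => (s, z)) y v = ((0 : ℝ), v) := by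
  rw [(hasFDerivAt_prodMk_right s y).fderiv]
  simp

theorem dMat_slice {F : ℝ × W → Matrix κ κ ℝ} {s : ℝ} {y : W} (hF : MatSmoothAt F (s, y)) (v : W) :
    dMat v (fun z => F (s, z)) y = dMat ((0 : ℝ), v) F (s, y) := by
  rw [dMat_comp (F := F) (f := fun z : W => (s, z)) hF (by fun_prop), fderiv_prodMk_right_apply]

/-- Derivatives of `F⁻¹ ∂_u F` and `F⁻¹ ∂_v F` differ by a commutator. -/
theorem dMat_inv_mul_dMat_comm {F : W → Matrix κ κ ℝ} {y : W} (hF : MatSmoothAt F y)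
    (h : (F y).det ≠ 0) (u v : W) :
    dMat u (fun z => (F z)⁻¹ * dMat v F z) y
      = dMat v (fun z => (F z)⁻¹ * dMat u F z) y
        + (F y)⁻¹ * dMat v F y * ((F y)⁻¹ * dMat u F y)
        - (F y)⁻¹ * dMat u F y * ((F y)⁻¹ * dMat v F y) := by
  rw [dMat_mul (hF.inv h) (hF.dMat v), dMat_mul (hF.inv h) (hF.dMat u), dMat_inv hF h,
    dMat_inv hF h, dMat_comm hF u v]
  simp only [Matrix.neg_mul, Matrix.mul_assoc]
  abel

variable {Ω : Set W} {g : W → Matrix ι ι ℝ} {G : W → Matrix κ κ ℝ} (β : Module.Basis ι ℝ W)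

/-- The energy density of a one-parameter family of maps, with the Riemannian density. -/
noncomputable def familyDensity (g : W → Matrix ι ι ℝ) (F : ℝ × W → Matrix κ κ ℝ) (q : ℝ × W) : ℝ :=
  ((1 / 2) * ∑ a, ∑ b, (g q.2)⁻¹ a b * (((F q)⁻¹ * dMat ((0 : ℝ), β a) F q)
    * ((F q)⁻¹ * dMat ((0 : ℝ), β b) F q)).trace) * Real.sqrt (g q.2).det

/-- `F⁻¹ ∂_s F` at `s = 0`. -/
noncomputable def variationField (F : ℝ × W → Matrix κ κ ℝ) (y : W) : Matrix κ κ ℝ :=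
  (F (0, y))⁻¹ * dMat ((1 : ℝ), (0 : W)) F (0, y)

/-- The vector field whose divergence is the exact part of the first variation. -/
noncomputable def variationFlux (g : W → Matrix ι ι ℝ) (G : W → Matrix κ κ ℝ)
    (F : ℝ × W → Matrix κ κ ℝ) (a : ι) (y : W) : ℝ :=
  (variationField F y * (Real.sqrt (g y).det • ((G y)⁻¹ * gradient β g G a y))).trace

theorem matSmoothAt_variationField {F : ℝ × W → Matrix κ κ ℝ} {y : W}
    (hF : MatSmoothAt F (0, y)) (h : (F (0, y)).det ≠ 0) : MatSmoothAt (variationField F) y :=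
  MatSmoothAt.comp (F := fun q => (F q)⁻¹ * dMat ((1 : ℝ), (0 : W)) F q)
    (f := fun z : W => ((0 : ℝ), z)) ((hF.inv h).mul (hF.dMat _)) (by fun_prop)

theorem LocalData.matSmoothAt_flux (hd : LocalData Ω g G) {y : W} (hy : y ∈ Ω) (a : ι) :
    MatSmoothAt (fun z => Real.sqrt (g z).det • ((G z)⁻¹ * gradient β g G a z)) y :=
  MatSmoothAt.smul (hd.contDiffAt_sqrt_det hy)
    ((hd.matSmoothAt_fiber_inv hy).mul (hd.matSmoothAt_gradient β hy a))

theorem LocalData.contDiffAt_variationFlux (hd : LocalData Ω g G) {F : ℝ × W → Matrix κ κ ℝ}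
    {y : W} (hy : y ∈ Ω) (hF : MatSmoothAt F (0, y)) (h : (F (0, y)).det ≠ 0) (a : ι) :
    ContDiffAt ℝ ∞ (variationFlux β g G F a) y :=
  ((matSmoothAt_variationField hF h).mul (hd.matSmoothAt_flux β hy a)).trace

theorem LocalData.contDiffAt_familyDensity (hd : LocalData Ω g G) {F : ℝ × W → Matrix κ κ ℝ}
    {q : ℝ × W} (hy : q.2 ∈ Ω) (hF : MatSmoothAt F q) (h : (F q).det ≠ 0) :
    ContDiffAt ℝ ∞ (familyDensity β g F) q := by
  have hA : ∀ a, MatSmoothAt (fun q => (F q)⁻¹ * dMat ((0 : ℝ), β a) F q) q :=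
    fun a => (hF.inv h).mul (hF.dMat _)
  refine ContDiffAt.mul (contDiffAt_const.mul ?_)
    ((hd.contDiffAt_sqrt_det hy).comp q contDiffAt_snd)
  exact contDiffAt_finset_sum fun a _ => contDiffAt_finset_sum fun b _ =>
    ((hd.matSmoothAt_base_inv hy a b).comp q contDiffAt_snd).mul ((hA a).mul (hA b)).trace

/-- By cyclicity the trace is $\operatorname{Tr}(L(A_bA_a - A_aA_b))$, antisymmetric in $a, b$,
while $g^{ab}$ is symmetric. -/
theorem LocalData.sum_commutator (hd : LocalData Ω g G) {y : W} (hy : y ∈ Ω)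
    (A : ι → Matrix κ κ ℝ) (L : Matrix κ κ ℝ) :
    ∑ a, ∑ b, (g y)⁻¹ a b * ((A a * L - L * A a) * A b).trace = 0 := by
  simp only [Matrix.sub_mul, Matrix.trace_sub, mul_sub, Finset.sum_sub_distrib]
  rw [sub_eq_zero, Finset.sum_comm]
  refine Finset.sum_congr rfl fun a _ => Finset.sum_congr rfl fun b _ => ?_
  rw [hd.base_inv_symm hy, Matrix.mul_assoc, Matrix.trace_mul_comm]

/-- With $L = F^{-1}\partial_s F$ and $A_a = F^{-1}\partial_a F$ one has $\partial_s A_a =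
\partial_a L + [A_a, L]$. The commutator contributes nothing to the energy, and the product rule
splits $\sqrt{\det g}\, g^{ab}\operatorname{Tr}(\partial_a L\, A_b)$ into a divergence and the
Euler-Lagrange pairing. -/
theorem LocalData.fderiv_familyDensity (hd : LocalData Ω g G) {F : ℝ × W → Matrix κ κ ℝ}
    {y : W} (hy : y ∈ Ω) (hF : MatSmoothAt F (0, y)) (h0 : ∀ z ∈ Ω, F (0, z) = G z) :
    fderiv ℝ (familyDensity β g F) (0, y) (1, 0)
      = ∑ a, fderiv ℝ (variationFlux β g G F a) y (β a)
        - (variationField F y * eulerLagrange β g G y).trace := by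
  have h : (F (0, y)).det ≠ 0 := by rw [h0 y hy]; exact (hd.posDef_fiber y hy).det_pos.ne'
  have hL := matSmoothAt_variationField hF h
  have hA : ∀ a, MatSmoothAt (fun q => (F q)⁻¹ * dMat ((0 : ℝ), β a) F q) (0, y) :=
    fun a => (hF.inv h).mul (hF.dMat _)
  have hgs : ContDiffAt ℝ ∞ (fun q : ℝ × W => Real.sqrt (g q.2).det) (0, y) :=
    ContDiffAt.comp (g := fun z => Real.sqrt (g z).det) (0, y) (hd.contDiffAt_sqrt_det hy)
      contDiffAt_snd
  have hgi : ∀ a b, ContDiffAt ℝ ∞ (fun q : ℝ × W => (g q.2)⁻¹ a b) (0, y) := fun a b =>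
    ContDiffAt.comp (g := fun z => (g z)⁻¹ a b) (0, y) (hd.matSmoothAt_base_inv hy a b)
      contDiffAt_snd
  have hsnd : ∀ f : W → ℝ, ContDiffAt ℝ ∞ f y →
      fderiv ℝ (fun q : ℝ × W => f q.2) (0, y) (1, 0) = 0 := by
    intro f hf
    rw [fderiv_fun_comp (g := f) (f := fun q : ℝ × W => q.2) (0, y) (contDiffAt_differentiableAt hf)
      differentiableAt_snd]
    simp [fderiv_snd]
  have hFG : ∀ a, dMat ((0 : ℝ), β a) F (0, y) = dMat (β a) G y := by
    intro a
    rw [← dMat_slice hF]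
    exact dMat_congr (Filter.eventually_of_mem (hd.isOpen.mem_nhds hy) h0) _
  have hdL : ∀ a, dMat ((0 : ℝ), β a) (fun q => (F q)⁻¹ * dMat ((1 : ℝ), (0 : W)) F q) (0, y)
      = dMat (β a) (variationField F) y := fun a =>
    (dMat_slice ((hF.inv h).mul (hF.dMat _)) (β a)).symm
  have hdA : ∀ a, dMat ((1 : ℝ), (0 : W)) (fun q => (F q)⁻¹ * dMat ((0 : ℝ), β a) F q) (0, y)
      = dMat (β a) (variationField F) y
        + ((G y)⁻¹ * dMat (β a) G y * variationField F y
          - variationField F y * ((G y)⁻¹ * dMat (β a) G y)) := by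
    intro a
    rw [dMat_inv_mul_dMat_comm hF h, hdL, hFG, variationField, h0 y hy]
    abel
  have hflux : ∀ a, fderiv ℝ (variationFlux β g G F a) y (β a)
      = Real.sqrt (g y).det * (dMat (β a) (variationField F) y
          * ((G y)⁻¹ * gradient β g G a y)).trace
        + (variationField F y * dMat (β a)
          (fun z => Real.sqrt (g z).det • ((G z)⁻¹ * gradient β g G a z)) y).trace := by
    intro a
    have := fderiv_trace (hL.mul (hd.matSmoothAt_flux β hy a)) (β a)
    refine this.trans ?_
    rw [dMat_mul hL (hd.matSmoothAt_flux β hy a), Matrix.trace_add, Matrix.mul_smul,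
      Matrix.trace_smul, smul_eq_mul]
  have hterm : ∀ a b, fderiv ℝ (fun q : ℝ × W => (g q.2)⁻¹ a b
      * (((F q)⁻¹ * dMat ((0 : ℝ), β a) F q) * ((F q)⁻¹ * dMat ((0 : ℝ), β b) F q)).trace)
        (0, y) (1, 0)
      = (g y)⁻¹ a b * (dMat (β a) (variationField F) y * ((G y)⁻¹ * dMat (β b) G y)).trace
        + (g y)⁻¹ a b * (dMat (β b) (variationField F) y * ((G y)⁻¹ * dMat (β a) G y)).trace
        + (g y)⁻¹ a b * (((G y)⁻¹ * dMat (β a) G y * variationField F y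
          - variationField F y * ((G y)⁻¹ * dMat (β a) G y)) * ((G y)⁻¹ * dMat (β b) G y)).trace
        + (g y)⁻¹ a b * (((G y)⁻¹ * dMat (β b) G y * variationField F y
          - variationField F y * ((G y)⁻¹ * dMat (β b) G y)) * ((G y)⁻¹ * dMat (β a) G y)).trace := by
    intro a b
    rw [fderiv_mul_apply (hgi a b) ((hA a).mul (hA b)).trace,
      hsnd (fun z => (g z)⁻¹ a b) (hd.matSmoothAt_base_inv hy a b),
      fderiv_trace ((hA a).mul (hA b)), dMat_mul (hA a) (hA b), hdA, hdA, hFG, hFG, h0 y hy,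
      Matrix.trace_add, Matrix.trace_mul_comm ((G y)⁻¹ * dMat (β a) G y) (dMat (β b) (variationField F) y + _)]
    simp only [Matrix.add_mul, Matrix.trace_add]
    ring
  have hsym : ∀ f : ι → ι → ℝ, ∑ a, ∑ b, (g y)⁻¹ a b * f b a = ∑ a, ∑ b, (g y)⁻¹ a b * f a b := by
    intro f
    rw [Finset.sum_comm]
    exact Finset.sum_congr rfl fun a _ => Finset.sum_congr rfl fun b _ => by
      rw [hd.base_inv_symm hy]
  have hgrad : ∀ a, (dMat (β a) (variationField F) y * ((G y)⁻¹ * gradient β g G a y)).trace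
      = ∑ b, (g y)⁻¹ a b
        * (dMat (β a) (variationField F) y * ((G y)⁻¹ * dMat (β b) G y)).trace := by
    intro a
    simp only [gradient, Finset.mul_sum, Matrix.mul_smul, Matrix.trace_sum, Matrix.trace_smul,
      smul_eq_mul]
  have hsum : ContDiffAt ℝ ∞ (fun q : ℝ × W => ∑ a, ∑ b, (g q.2)⁻¹ a b
      * (((F q)⁻¹ * dMat ((0 : ℝ), β a) F q) * ((F q)⁻¹ * dMat ((0 : ℝ), β b) F q)).trace)
      (0, y) :=
    contDiffAt_finset_sum fun a _ => contDiffAt_finset_sum fun b _ =>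
      (hgi a b).mul ((hA a).mul (hA b)).trace
  unfold familyDensity
  rw [fderiv_mul_apply (contDiffAt_const.mul hsum) hgs, hsnd _ (hd.contDiffAt_sqrt_det hy),
    fderiv_mul_apply contDiffAt_const hsum,
    fderiv_sum_apply fun a _ => contDiffAt_finset_sum fun b _ =>
      (hgi a b).mul ((hA a).mul (hA b)).trace]
  have hin : ∀ a, fderiv ℝ (fun q : ℝ × W => ∑ b, (g q.2)⁻¹ a b
      * (((F q)⁻¹ * dMat ((0 : ℝ), β a) F q) * ((F q)⁻¹ * dMat ((0 : ℝ), β b) F q)).trace)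
      (0, y) (1, 0) = _ := fun a => fderiv_sum_apply (fun b _ =>
        (hgi a b).mul ((hA a).mul (hA b)).trace) _
  simp only [hin, hterm, hflux, Finset.sum_add_distrib, hgrad, eulerLagrange, Finset.mul_sum,
    Matrix.trace_sum, fderiv_fun_const, Pi.zero_apply, zero_apply, zero_mul, Finset.sum_const_zero]
  simp only [← Finset.mul_sum]
  -- Exchanging `a` and `b` identifies the terms in pairs: the derivative terms double and absorb
  -- the factor $\frac12$ of the energy, the commutator terms vanish.
  rw [hsym fun a b => (dMat (β a) (variationField F) y * ((G y)⁻¹ * dMat (β b) G y)).trace,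
    hsym fun a b => (((G y)⁻¹ * dMat (β a) G y * variationField F y
          - variationField F y * ((G y)⁻¹ * dMat (β a) G y)) * ((G y)⁻¹ * dMat (β b) G y)).trace,
    hd.sum_commutator hy (fun a => (G y)⁻¹ * dMat (β a) G y)]
  ring

end FirstVariation

/-! ### Harmonic maps and the Euler-Lagrange equation -/

/-! ### Differentiation of integrals over compact sets, and integration by parts. -/

section Integrals

variable {W : Type*} [NormedAddCommGroup W] [NormedSpace ℝ W] [FiniteDimensional ℝ W]
  [MeasurableSpace W] [BorelSpace W] (μ : Measure W) [μ.IsAddHaarMeasure]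

/-- Differentiation under the integral sign over a compact set. -/
theorem hasDerivAt_setIntegral_of_contDiffAt {K Ω : Set W} (hK : IsCompact K) (hKΩ : K ⊆ Ω)
    {ε : ℝ} (hε : 0 < ε) {e : ℝ × W → ℝ}
    (he : ∀ q ∈ Ioo (-ε) ε ×ˢ Ω, ContDiffAt ℝ ∞ e q) :
    HasDerivAt (fun s => ∫ y in K, e (s, y) ∂μ) (∫ y in K, fderiv ℝ e (0, y) (1, 0) ∂μ) 0 := by
  have hcont : ∀ s ∈ Ioo (-ε) ε, ContinuousOn (fun y => e (s, y)) K := fun s hs y hy =>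
    (ContinuousAt.comp (f := fun z : W => (s, z)) (he (s, y) ⟨hs, hKΩ hy⟩).continuousAt
      (by fun_prop)).continuousWithinAt
  -- Halving the interval gives a compact set of parameters, so the derivative in `s` is bounded by
  -- a constant over it and `K`.
  have hI : Icc (-(ε / 2)) (ε / 2) ⊆ Ioo (-ε) ε := fun s hs =>
    ⟨by linarith [hs.1], by linarith [hs.2]⟩
  have h0 : (0 : ℝ) ∈ Ioo (-ε) ε := ⟨by linarith, hε⟩
  have hcont' : ContinuousOn (fun q => fderiv ℝ e q (1, 0)) (Icc (-(ε / 2)) (ε / 2) ×ˢ K) :=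
    fun q hq => (contDiffAt_fderiv_apply (he q ⟨hI hq.1, hKΩ hq.2⟩) _).continuousAt.continuousWithinAt
  obtain ⟨C, hC⟩ := (isCompact_Icc.prod hK).exists_bound_of_continuousOn hcont'
  have hcont0 : ContinuousOn (fun y => fderiv ℝ e (0, y) (1, 0)) K := fun y hy =>
    (ContinuousAt.comp (f := fun z : W => ((0 : ℝ), z))
      (contDiffAt_fderiv_apply (he (0, y) ⟨h0, hKΩ hy⟩) (1, 0)).continuousAt
      (by fun_prop)).continuousWithinAt
  refine (hasDerivAt_integral_of_dominated_loc_of_deriv_le (s := Icc (-(ε / 2)) (ε / 2))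
    (F := fun s y => e (s, y)) (F' := fun s y => fderiv ℝ e (s, y) (1, 0)) (bound := fun _ => C)
    (Icc_mem_nhds (by linarith) (by linarith)) ?_ ?_ ?_ ?_ ?_ ?_).2
  · filter_upwards [Ioo_mem_nhds h0.1 h0.2] with s hs
    exact (hcont s hs).aestronglyMeasurable hK.measurableSet
  · exact (hcont 0 h0).integrableOn_compact hK
  · exact hcont0.aestronglyMeasurable hK.measurableSet
  · filter_upwards [ae_restrict_mem hK.measurableSet] with y hy s hs
    exact hC (s, y) ⟨hs, hy⟩
  · exact integrableOn_const hK.measure_lt_top.ne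
  · filter_upwards [ae_restrict_mem hK.measurableSet] with y hy s hs
    have h1 := (contDiffAt_differentiableAt (he (s, y) ⟨hI hs, hKΩ hy⟩)).hasFDerivAt
    have h2 : HasDerivAt (fun s : ℝ => (s, y)) ((1 : ℝ), (0 : W)) s :=
      (hasDerivAt_id s).prodMk (hasDerivAt_const s y)
    exact h1.comp_hasDerivAt s h2

/-- The integral of a derivative over a compact set outside of which the function vanishes. -/
theorem setIntegral_fderiv_eq_zero {K Ω : Set W} (hK : IsCompact K) (hΩ : IsOpen Ω)
    (hKΩ : K ⊆ Ω) {X : W → ℝ} (hX : ∀ y ∈ Ω, ContDiffAt ℝ ∞ X y) (h0 : ∀ y ∈ Ω \ K, X y = 0)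
    (v : W) : ∫ y in K, fderiv ℝ X y v ∂μ = 0 := by
  -- Extension by zero is smooth on the whole space: it agrees with `X` on the open set `Ω` and
  -- vanishes on the open complement of `K`.
  have h1 : ∀ y ∈ Ω, K.indicator X =ᶠ[𝓝 y] X := fun y hy =>
    Filter.eventually_of_mem (hΩ.mem_nhds hy) fun z hz => by
      by_cases hzK : z ∈ K
      · exact indicator_of_mem hzK X
      · rw [indicator_of_notMem hzK, h0 z ⟨hz, hzK⟩]
  have h2 : ∀ y ∉ K, K.indicator X =ᶠ[𝓝 y] fun _ => 0 := fun y hy =>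
    Filter.eventually_of_mem (hK.isClosed.isOpen_compl.mem_nhds hy) fun z hz =>
      indicator_of_notMem hz X
  have hY : ContDiff ℝ ∞ (K.indicator X) := by
    rw [contDiff_iff_contDiffAt]
    intro y
    by_cases hy : y ∈ K
    · exact (hX y (hKΩ hy)).congr_of_eventuallyEq (h1 y (hKΩ hy))
    · exact contDiffAt_const.congr_of_eventuallyEq (h2 y hy)
  have hsupp : HasCompactSupport (K.indicator X) :=
    HasCompactSupport.intro hK fun y hy => indicator_of_notMem hy X
  have hcont : Continuous fun y => fderiv ℝ (K.indicator X) y v :=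
    (hY.continuous_fderiv (by simp)).clm_apply continuous_const
  calc ∫ y in K, fderiv ℝ X y v ∂μ = ∫ y in K, fderiv ℝ (K.indicator X) y v ∂μ :=
        setIntegral_congr_fun hK.measurableSet fun y hy => by
          simp only [(h1 y (hKΩ hy)).fderiv_eq]
    _ = ∫ y, fderiv ℝ (K.indicator X) y v ∂μ :=
        setIntegral_eq_integral_of_forall_compl_eq_zero fun y hy => by
          simp [(h2 y hy).fderiv_eq]
    _ = 0 := by
        -- Integration by parts against the constant function 1.
        have := integral_mul_fderiv_eq_neg_fderiv_mul_of_integrable (μ := μ) (f := fun _ => (1 : ℝ))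
          (g := K.indicator X) (v := v) (by simp)
          (by simpa using hcont.integrable_of_hasCompactSupport (hsupp.fderiv_apply ℝ v))
          (by simpa using hY.continuous.integrable_of_hasCompactSupport hsupp)
          (fun _ _ => differentiableAt_const _)
          (fun y _ => hY.differentiable (by simp) y)
        simpa using this

end Integrals

/-! ### Algebra of the Euler-Lagrange expression, and the test variations. -/

section Harmonic

variable {W : Type*} [NormedAddCommGroup W] [NormedSpace ℝ W] {ι κ : Type*} [Fintype ι]
  [DecidableEq ι] [Fintype κ] [DecidableEq κ] {Ω : Set W} {g : W → Matrix ι ι ℝ}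
  {G : W → Matrix κ κ ℝ} (β : Module.Basis ι ℝ W)

theorem LocalData.mono {Ω' : Set W} (hd : LocalData Ω g G) (h : Ω' ⊆ Ω) (ho : IsOpen Ω') :
    LocalData Ω' g G where
  isOpen := ho
  smooth_base y hy := hd.smooth_base y (h hy)
  posDef_base y hy := hd.posDef_base y (h hy)
  smooth_fiber y hy := hd.smooth_fiber y (h hy)
  posDef_fiber y hy := hd.posDef_fiber y (h hy)
  det_fiber y hy := hd.det_fiber y (h hy)

theorem dMat_slice_left {F : ℝ × W → Matrix κ κ ℝ} {s : ℝ} {y : W} (hF : MatSmoothAt F (s, y)) :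
    dMat (1 : ℝ) (fun r => F (r, y)) s = dMat ((1 : ℝ), (0 : W)) F (s, y) := by
  rw [dMat_comp (F := F) (f := fun r : ℝ => (r, y)) hF (by fun_prop),
    (hasFDerivAt_prodMk_left s y).fderiv]
  simp

theorem LocalData.matSmoothAt_eulerLagrange (hd : LocalData Ω g G) {y : W} (hy : y ∈ Ω) :
    MatSmoothAt (eulerLagrange β g G) y :=
  MatSmoothAt.sum fun a _ => (hd.matSmoothAt_flux β hy a).dMat _

/-- Volume preservation makes the flux trace-free on all of `Ω`, hence also its divergence. This
supplies the scalar direction, which variations of fixed determinant cannot test. -/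
theorem LocalData.trace_eulerLagrange (hd : LocalData Ω g G) {y : W} (hy : y ∈ Ω) :
    (eulerLagrange β g G y).trace = 0 := by
  rw [eulerLagrange, Matrix.trace_sum]
  refine Finset.sum_eq_zero fun a _ => ?_
  rw [← fderiv_trace (hd.matSmoothAt_flux β hy a)]
  have : (fun z => (Real.sqrt (g z).det • ((G z)⁻¹ * gradient β g G a z)).trace)
      =ᶠ[𝓝 y] fun _ => 0 :=
    Filter.eventually_of_mem (hd.isOpen.mem_nhds hy) fun z hz => by
      simp only [gradient, Finset.mul_sum, Matrix.mul_smul, Matrix.trace_smul, Matrix.trace_sum,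
        hd.trace_inv_mul_dMat hz, smul_zero, Finset.sum_const_zero]
  rw [this.fderiv_eq]
  simp

theorem LocalData.fiber_inv_transpose (hd : LocalData Ω g G) {y : W} (hy : y ∈ Ω) :
    (G y)⁻¹.transpose = (G y)⁻¹ := by
  ext i j
  exact hd.fiber_inv_symm hy j i

theorem LocalData.gradient_transpose (hd : LocalData Ω g G) {y : W} (hy : y ∈ Ω) (a : ι) :
    (gradient β g G a y).transpose = gradient β g G a y := by
  have h2 : ∀ a, (dMat (β a) G y).transpose = dMat (β a) G y := by
    intro a
    ext i j
    exact hd.pd_fiber_symm hy β a j i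
  simp only [gradient, Matrix.transpose_sum, Matrix.transpose_smul, h2]

/-- Each sum in the expansion `LocalData.fiber_mul_eulerLagrange` is symmetric. As a consequence
both halves of $A^TG + GA$ pair equally with the Euler-Lagrange expression. -/
theorem LocalData.fiber_mul_eulerLagrange_transpose (hd : LocalData Ω g G) {y : W} (hy : y ∈ Ω) :
    (G y * eulerLagrange β g G y).transpose = G y * eulerLagrange β g G y := by
  have h1 : ∀ a, (dMat (β a) (gradient β g G a) y).transpose = dMat (β a) (gradient β g G a) y := by
    intro a
    rw [← dMat_transpose]
    exact dMat_congr (Filter.eventually_of_mem (hd.isOpen.mem_nhds hy) fun z hz =>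
      hd.gradient_transpose β hz a) _
  have h2 : (∑ a, dMat (β a) G y * (G y)⁻¹ * gradient β g G a y).transpose
      = ∑ a, dMat (β a) G y * (G y)⁻¹ * gradient β g G a y := by
    ext i j
    exact hd.sum_mul_gradient_symm β hy i j
  rw [hd.fiber_mul_eulerLagrange β hy]
  simp only [Finset.sum_sub_distrib, Finset.sum_add_distrib, Matrix.transpose_smul,
    Matrix.transpose_sub, Matrix.transpose_add, h2]
  simp only [Matrix.transpose_sum, Matrix.transpose_smul, h1, hd.gradient_transpose β hy]

/-- A trace-free matrix is zero if it pairs to zero with all nilpotent matrices of rank one. -/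
theorem eq_zero_of_trace_vecMulVec {D : Matrix κ κ ℝ} (h0 : D.trace = 0)
    (h : ∀ u v : κ → ℝ, v ⬝ᵥ u = 0 → (Matrix.vecMulVec u v * D).trace = 0) : D = 0 := by
  have h' : ∀ u v : κ → ℝ, v ⬝ᵥ u = 0 → v ⬝ᵥ D.mulVec u = 0 := by
    intro u v huv
    rw [← h u v huv, Matrix.trace_mul_comm, Matrix.mul_vecMulVec, Matrix.trace_vecMulVec,
      dotProduct_comm]
  have hoff : ∀ i j, i ≠ j → D i j = 0 := by
    intro i j hij
    -- Distinct basis vectors isolate an off-diagonal entry. The orthogonal pair $e_i + e_j$, $e_i -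
    -- e_j$ below gives $D_{ii} - D_{jj}$, so the trace condition finishes the diagonal.
    have := h' (Pi.single j 1) (Pi.single i 1) (by simp [hij])
    simpa using this
  have hdiag : ∀ i j, D i i = D j j := by
    intro i j
    by_cases hij : i = j
    · rw [hij]
    have := h' (Pi.single i 1 + Pi.single j 1) (Pi.single i 1 - Pi.single j 1) (by
      simp [hij, Ne.symm hij])
    simp [Matrix.mulVec_add, hoff i j hij, hoff j i (Ne.symm hij)] at this
    linarith
  ext i j
  by_cases hij : i = j
  · subst hij
    have h1 : (Fintype.card κ : ℝ) * D i i = 0 := by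
      rw [← h0, Matrix.trace]
      simp only [Matrix.diag_apply, fun k => hdiag k i]
      simp
    have h2 : (Fintype.card κ : ℝ) ≠ 0 :=
      Nat.cast_ne_zero.2 (Fintype.card_pos_iff.2 ⟨i⟩).ne'
    simpa [h2] using h1
  · exact hoff i j hij

/-- The variation of `G` through `(1 + s φ A)ᵀ G (1 + s φ A)`. -/
noncomputable def conjVariation (G : W → Matrix κ κ ℝ) (φ : W → ℝ) (A : Matrix κ κ ℝ)
    (q : ℝ × W) : Matrix κ κ ℝ :=
  (1 + (q.1 * φ q.2) • A).transpose * G q.2 * (1 + (q.1 * φ q.2) • A)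

theorem matSmoothAt_conjVariation {φ : W → ℝ} {q : ℝ × W} (hφ : ContDiffAt ℝ ∞ φ q.2)
    (hG : MatSmoothAt G q.2) (A : Matrix κ κ ℝ) : MatSmoothAt (conjVariation G φ A) q := by
  have h1 : MatSmoothAt (fun q : ℝ × W => 1 + (q.1 * φ q.2) • A) q :=
    (matSmoothAt_const _ _).add (MatSmoothAt.smul
      (contDiffAt_fst.mul (ContDiffAt.comp (g := φ) q hφ contDiffAt_snd)) (matSmoothAt_const _ _))
  exact (h1.transpose.mul (MatSmoothAt.comp (F := G) hG contDiffAt_snd)).mul h1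

theorem variationField_conjVariation {φ : W → ℝ} {y : W} (hφ : ContDiffAt ℝ ∞ φ y)
    (hG : MatSmoothAt G y) (A : Matrix κ κ ℝ) :
    variationField (conjVariation G φ A) y
      = φ y • ((G y)⁻¹ * (A.transpose * G y + G y * A)) := by
  have h0 : ContDiffAt ℝ ∞ (fun s : ℝ => s * φ y) (0 : ℝ) := by fun_prop
  have h1 : MatSmoothAt (fun s : ℝ => (s * φ y) • A) (0 : ℝ) :=
    MatSmoothAt.smul h0 (matSmoothAt_const _ _)
  have h2 : MatSmoothAt (fun s : ℝ => 1 + (s * φ y) • A) (0 : ℝ) := (matSmoothAt_const _ _).add h1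
  have h3 : dMat (1 : ℝ) (fun s : ℝ => 1 + (s * φ y) • A) 0 = φ y • A := by
    rw [dMat_add (matSmoothAt_const _ _) h1, dMat_const, zero_add,
      dMat_smul h0 (matSmoothAt_const _ _), dMat_const, fderiv_mul_const (by fun_prop)]
    simp
  rw [variationField, ← dMat_slice_left (matSmoothAt_conjVariation (q := (0, y)) hφ hG A)]
  change _ * dMat (1 : ℝ) (fun s : ℝ => (1 + (s * φ y) • A).transpose * G y * (1 + (s * φ y) • A)) 0
    = _
  rw [dMat_mul (h2.transpose.mul (matSmoothAt_const _ _)) h2,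
    dMat_mul h2.transpose (matSmoothAt_const _ _), dMat_transpose, dMat_const, h3]
  simp [conjVariation, ← smul_add]

/-- Transposing the $A^T$ half inside the trace, with $G$ and $G$ times the Euler-Lagrange
expression symmetric, turns it into the $A$ half; this is the factor 2. -/
theorem LocalData.trace_variationField_conjVariation (hd : LocalData Ω g G) {φ : W → ℝ} {y : W}
    (hy : y ∈ Ω) (hφ : ContDiffAt ℝ ∞ φ y) (A : Matrix κ κ ℝ) :
    (variationField (conjVariation G φ A) y * eulerLagrange β g G y).trace
      = φ y * (2 * (A * eulerLagrange β g G y).trace) := by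
  rw [variationField_conjVariation hφ (hd.smooth_fiber y hy)]
  have hu : IsUnit (G y).det := isUnit_iff_ne_zero.2 (hd.posDef_fiber y hy).det_pos.ne'
  have e1 : (G y)⁻¹ * (A.transpose * G y + G y * A) * eulerLagrange β g G y
      = (G y)⁻¹ * A.transpose * (G y * eulerLagrange β g G y) + A * eulerLagrange β g G y := by
    rw [Matrix.mul_add, Matrix.nonsing_inv_mul_cancel_left _ _ hu, Matrix.add_mul]
    simp only [Matrix.mul_assoc]
  have e2 : ((G y)⁻¹ * A.transpose * (G y * eulerLagrange β g G y)).trace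
      = (A * eulerLagrange β g G y).trace := by
    rw [← Matrix.trace_transpose]
    simp only [Matrix.transpose_mul _ (G y * eulerLagrange β g G y),
      hd.fiber_mul_eulerLagrange_transpose β hy]
    rw [Matrix.transpose_mul, hd.fiber_inv_transpose hy, Matrix.transpose_transpose,
      Matrix.trace_mul_comm, Matrix.mul_assoc, Matrix.nonsing_inv_mul_cancel_left _ _ hu]
  rw [Matrix.smul_mul, Matrix.trace_smul, e1, Matrix.trace_add, e2, smul_eq_mul]
  ring

end Harmonic

/-! ### Criticality of the energy and the Euler-Lagrange equation. -/

section HarmonicMap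

variable {n N : ℕ} {Ω : Set (EuclideanSpace ℝ (Fin n))}
  {g : EuclideanSpace ℝ (Fin n) → Matrix (Fin n) (Fin n) ℝ}
  {G : EuclideanSpace ℝ (Fin n) → Matrix (Fin N) (Fin N) ℝ}

/-- The first variation formula. -/
theorem LocalData.hasDerivAt_energy (hd : LocalData Ω g G) {K : Set (EuclideanSpace ℝ (Fin n))}
    (hK : IsCompact K) (hKΩ : K ⊆ Ω) {ε : ℝ} (hε : 0 < ε)
    {F : ℝ → EuclideanSpace ℝ (Fin n) → Matrix (Fin N) (Fin N) ℝ}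
    (hF : ∀ q ∈ Ioo (-ε) ε ×ˢ Ω, MatSmoothAt (fun q : ℝ × EuclideanSpace ℝ (Fin n) => F q.1 q.2) q)
    (hdet : ∀ s ∈ Ioo (-ε) ε, ∀ y ∈ Ω, (F s y).det ≠ 0) (h0 : ∀ y ∈ Ω, F 0 y = G y)
    (hoff : ∀ s ∈ Ioo (-ε) ε, ∀ y ∈ Ω \ K, F s y = G y) :
    HasDerivAt (fun s => energy g K (F s))
      (-∫ y in K, (variationField (fun q => F q.1 q.2) y
        * eulerLagrange (stdBasis n) g G y).trace) 0 := by
  have hz : (0 : ℝ) ∈ Ioo (-ε) ε := ⟨by linarith, hε⟩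
  set 𝔽 : ℝ × EuclideanSpace ℝ (Fin n) → Matrix (Fin N) (Fin N) ℝ := fun q => F q.1 q.2 with h𝔽
  have hmain := hasDerivAt_setIntegral_of_contDiffAt volume hK hKΩ hε
    (e := familyDensity (stdBasis n) g 𝔽)
    (fun q hq => hd.contDiffAt_familyDensity (stdBasis n) hq.2 (hF q hq) (hdet q.1 hq.1 q.2 hq.2))
  have heq : (fun s => energy g K (F s))
      =ᶠ[𝓝 0] fun s => ∫ y in K, familyDensity (stdBasis n) g 𝔽 (s, y) := by
    filter_upwards [Ioo_mem_nhds hz.1 hz.2] with s hs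
    refine setIntegral_congr_fun hK.measurableSet fun y hy => ?_
    simp only [energyDensity, familyDensity, spdMetric, pdMat_eq_dMat]
    have : ∀ a, dMat ((0 : ℝ), stdBasis n a) 𝔽 (s, y) = dMat (stdBasis n a) (F s) y := fun a =>
      (dMat_slice (F := 𝔽) (hF (s, y) ⟨hs, hKΩ hy⟩) (stdBasis n a)).symm
    have hs𝔽 : 𝔽 (s, y) = F s y := rfl
    simp only [this, hs𝔽, Matrix.mul_assoc]
  refine (hmain.congr_of_eventuallyEq heq).congr_deriv ?_
  have hX : ∀ a, ∀ y ∈ Ω, ContDiffAt ℝ ∞ (variationFlux (stdBasis n) g G 𝔽 a) y := fun a y hy =>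
    hd.contDiffAt_variationFlux (stdBasis n) hy (hF (0, y) ⟨hz, hy⟩) (hdet 0 hz y hy) a
  -- Off `K` the family does not depend on `s`, so the flux vanishes there and its divergence
  -- integrates to zero.
  have hX0 : ∀ a, ∀ y ∈ Ω \ K, variationFlux (stdBasis n) g G 𝔽 a y = 0 := by
    intro a y hy
    have : dMat ((1 : ℝ), (0 : EuclideanSpace ℝ (Fin n))) 𝔽 (0, y) = 0 := by
      rw [← dMat_slice_left (F := 𝔽) (hF (0, y) ⟨hz, hy.1⟩), ← dMat_const (1 : ℝ) (G y) 0]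
      exact dMat_congr (Filter.eventually_of_mem (Ioo_mem_nhds hz.1 hz.2) fun s hs =>
        hoff s hs y hy) _
    rw [variationFlux, variationField, this]
    simp
  have hL : ∀ y ∈ Ω, ContDiffAt ℝ ∞
      (fun y => (variationField 𝔽 y * eulerLagrange (stdBasis n) g G y).trace) y := fun y hy =>
    ((matSmoothAt_variationField (hF (0, y) ⟨hz, hy⟩) (hdet 0 hz y hy)).mul
      (hd.matSmoothAt_eulerLagrange (stdBasis n) hy)).trace
  have hi1 : ∀ a, IntegrableOn
      (fun y => fderiv ℝ (variationFlux (stdBasis n) g G 𝔽 a) y (stdBasis n a)) K := fun a =>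
    ContinuousOn.integrableOn_compact hK fun y hy =>
      (contDiffAt_fderiv_apply (hX a y (hKΩ hy)) _).continuousAt.continuousWithinAt
  have hi2 : IntegrableOn
      (fun y => (variationField 𝔽 y * eulerLagrange (stdBasis n) g G y).trace) K :=
    ContinuousOn.integrableOn_compact hK fun y hy =>
      (hL y (hKΩ hy)).continuousAt.continuousWithinAt
  calc ∫ y in K, fderiv ℝ (familyDensity (stdBasis n) g 𝔽) (0, y) (1, 0)
      = ∫ y in K, (∑ a, fderiv ℝ (variationFlux (stdBasis n) g G 𝔽 a) y (stdBasis n a)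
        - (variationField 𝔽 y * eulerLagrange (stdBasis n) g G y).trace) :=
        setIntegral_congr_fun hK.measurableSet fun y hy =>
          hd.fderiv_familyDensity (stdBasis n) (hKΩ hy) (hF (0, y) ⟨hz, hKΩ hy⟩) h0
    _ = _ := by
        rw [integral_sub (integrable_finsetSum _ fun a _ => hi1 a) hi2,
          integral_finsetSum _ fun a _ => hi1 a,
          Finset.sum_eq_zero fun a _ => setIntegral_fderiv_eq_zero volume hK hd.isOpen hKΩ
            (hX a) (hX0 a) _, zero_sub]

theorem spdDet_conj {c : ℝ} {G P : Matrix (Fin N) (Fin N) ℝ} (hG : G ∈ spdDet N c)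
    (hP : P.det = 1) : P.transpose * G * P ∈ spdDet N c := by
  refine ⟨?_, by simp [hP, hG.2]⟩
  have h := hG.1.conjTranspose_mul_mul_same (B := P)
    (Matrix.mulVec_injective_of_isUnit ((Matrix.isUnit_iff_isUnit_det P).2 (by simp [hP])))
  rwa [Matrix.conjTranspose_eq_transpose_of_trivial] at h

/-- The fundamental lemma of the calculus of variations, applied for each rank-one nilpotent $A$ to
the scalar function that pairs $A$ with the Euler-Lagrange expression; the cut-off `φ` localizes the
variation. -/
theorem LocalData.eulerLagrange_eq_zero (hd : LocalData Ω g G) {c : ℝ}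
    (h : IsHarmonicMapOn Ω g c G) {y : EuclideanSpace ℝ (Fin n)} (hy : y ∈ Ω) :
    eulerLagrange (stdBasis n) g G y = 0 := by
  refine eq_zero_of_trace_vecMulVec (hd.trace_eulerLagrange _ hy) fun u v huv => ?_
  set A := Matrix.vecMulVec u v with hA
  -- The determinant is $1 + r\, v\cdot u$. Orthogonality therefore keeps the variation in `spdDet N
  -- c` for every `s`, and not merely to first order.
  have hdetA : ∀ r : ℝ, (1 + r • A).det = 1 := by
    intro r
    rw [hA, ← Matrix.smul_vecMulVec, Matrix.vecMulVec_eq Unit,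
      Matrix.det_one_add_replicateCol_mul_replicateRow, dotProduct_smul, huv]
    simp
  have hsm : ∀ z ∈ Ω, ContDiffAt ℝ ∞ (fun z => (A * eulerLagrange (stdBasis n) g G z).trace) z :=
    fun z hz => ((matSmoothAt_const A z).mul (hd.matSmoothAt_eulerLagrange _ hz)).trace
  have hcont : ContinuousOn (fun z => (A * eulerLagrange (stdBasis n) g G z).trace) Ω :=
    fun z hz => (hsm z hz).continuousAt.continuousWithinAt
  have hae := hd.isOpen.ae_eq_zero_of_integral_contDiff_smul_eq_zero (μ := volume)
    (hcont.locallyIntegrableOn hd.isOpen.measurableSet) ?_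
  -- Continuity upgrades vanishing almost everywhere to vanishing at the given point.
  · have := Measure.eqOn_open_of_ae_eq (μ := volume) (U := Ω)
      (g := fun _ => (0 : ℝ)) ((ae_restrict_iff' hd.isOpen.measurableSet).2 hae) hd.isOpen hcont
      continuousOn_const
    exact this hy
  intro φ hφ hφc hφΩ
  have hsmooth : ∀ q : ℝ × EuclideanSpace ℝ (Fin n), q.2 ∈ Ω →
      MatSmoothAt (conjVariation G φ A) q := fun q hq =>
    matSmoothAt_conjVariation hφ.contDiffAt (hd.smooth_fiber _ hq) A
  have hmem : ∀ s, ∀ z ∈ Ω, conjVariation G φ A (s, z) ∈ spdDet N c := fun s z hz =>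
    spdDet_conj (h.mapsTo hz) (hdetA _)
  have hzero : ∀ z, conjVariation G φ A (0, z) = G z := fun z => by simp [conjVariation]
  have hoff : ∀ s, ∀ z ∈ Ω \ tsupport φ, conjVariation G φ A (s, z) = G z := fun s z hz => by
    simp [conjVariation, image_eq_zero_of_notMem_tsupport hz.2]
  have h1 := h.critical (tsupport φ) hφc hφΩ 1 one_pos (fun s z => conjVariation G φ A (s, z))
    (fun i j q hq => (hsmooth q hq.2 i j).contDiffWithinAt) (fun s _ z hz => hmem s z hz)
    (fun z _ => hzero z) (fun s _ => hoff s)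
  have h2 := hd.hasDerivAt_energy hφc hφΩ one_pos (F := fun s z => conjVariation G φ A (s, z))
    (fun q hq => hsmooth q hq.2) (fun s _ z hz => (hmem s z hz).1.det_pos.ne') (fun z _ => hzero z)
    (fun s _ => hoff s)
  have h3 := neg_eq_zero.1 (h2.unique h1)
  rw [setIntegral_congr_fun hφc.measurableSet fun z hz =>
    hd.trace_variationField_conjVariation (stdBasis n) (hφΩ hz) hφ.contDiffAt A,
    setIntegral_eq_integral_of_forall_compl_eq_zero fun z hz => by
      simp [image_eq_zero_of_notMem_tsupport hz]] at h3
  have h4 : ∀ z, φ z * (2 * (A * eulerLagrange (stdBasis n) g G z).trace)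
      = 2 * (φ z • (A * eulerLagrange (stdBasis n) g G z).trace) := fun z => by
    rw [smul_eq_mul]; ring
  simp only [h4, integral_const_mul] at h3
  simpa using h3

theorem LocalData.isHarmonicMapOn (hd : LocalData Ω g G) {c : ℝ} (hc : ∀ y ∈ Ω, (G y).det = c)
    (h : ∀ y ∈ Ω, eulerLagrange (stdBasis n) g G y = 0) : IsHarmonicMapOn Ω g c G where
  smooth i j y hy := (hd.smooth_fiber y hy i j).contDiffWithinAt
  mapsTo y hy := ⟨hd.posDef_fiber y hy, hc y hy⟩
  critical K hK hKΩ ε hε F hF hmem h0 hoff := by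
    have hopen : IsOpen (Ioo (-ε) ε ×ˢ Ω) := isOpen_Ioo.prod hd.isOpen
    refine (hd.hasDerivAt_energy hK hKΩ hε
      (fun q hq i j => (hF i j).contDiffAt (hopen.mem_nhds hq))
      (fun s hs y hy => (hmem s hs hy).1.det_pos.ne') h0 hoff).congr_deriv ?_
    rw [setIntegral_congr_fun (g := fun _ => (0 : ℝ)) hK.measurableSet fun y hy => by
      simp only [h y (hKΩ hy), Matrix.mul_zero, Matrix.trace_zero]]
    simp

end HarmonicMap

/-! ### Reading the bundle in charts -/

/-! ### Smoothness of metric components in local frames. -/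

section Metrics

variable {n : ℕ} {B : Type*} [TopologicalSpace B] [ChartedSpace (EuclideanSpace ℝ (Fin n)) B]
  {F : Type*} [NormedAddCommGroup F] [NormedSpace ℝ F]
  {E : B → Type*} [∀ b, AddCommGroup (E b)] [∀ b, Module ℝ (E b)]
  [∀ b, TopologicalSpace (E b)] [∀ b, IsTopologicalAddGroup (E b)]
  [∀ b, ContinuousConstSMul ℝ (E b)] [TopologicalSpace (TotalSpace F E)]
  [FiberBundle F E] [VectorBundle ℝ F E]

/-- In the trivialization `e` this section is constant. -/
theorem contMDiffAt_section_symm [ContMDiffVectorBundle ∞ F E (𝓡 n)]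
    (e : Trivialization F (π F E)) [MemTrivializationAtlas e] {b : B} (hb : b ∈ e.baseSet) (v : F) :
    ContMDiffAt (𝓡 n) ((𝓡 n).prod 𝓘(ℝ, F)) ∞ (fun b => TotalSpace.mk' F b (e.symm b v)) b := by
  rw [e.contMDiffAt_section_iff hb]
  refine (contMDiffAt_const (c := v)).congr_of_eventuallyEq ?_
  filter_upwards [e.open_baseSet.mem_nhds hb] with b' hb'
  rw [e.apply_mk_symm hb']

theorem contMDiffAt_inner_symm [ContMDiffVectorBundle ∞ F E (𝓡 n)]
    (h : ContMDiffRiemannianMetric (𝓡 n) ∞ F E)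
    (e : Trivialization F (π F E)) [MemTrivializationAtlas e] {b : B} (hb : b ∈ e.baseSet)
    (v w : F) :
    ContMDiffAt (𝓡 n) 𝓘(ℝ, ℝ) ∞ (fun b => h.inner b (e.symm b v) (e.symm b w)) b := by
  have := ContMDiffAt.clm_bundle_apply₂ (F₁ := F) (F₂ := F) (F₃ := ℝ) (E₃ := Bundle.Trivial B ℝ)
    (b := fun b : B => b) (h.contMDiff b)
    (contMDiffAt_section_symm e hb v) (contMDiffAt_section_symm e hb w)
  rw [contMDiffAt_totalSpace] at this
  exact this.2

theorem contDiffAt_inner_symm [IsManifold (𝓡 n) ∞ B] [ContMDiffVectorBundle ∞ F E (𝓡 n)]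
    (h : ContMDiffRiemannianMetric (𝓡 n) ∞ F E)
    (e : Trivialization F (π F E)) [MemTrivializationAtlas e] {b : B} {y : EuclideanSpace ℝ (Fin n)}
    (hy : y ∈ (extChartAt (𝓡 n) b).target) (hb : (extChartAt (𝓡 n) b).symm y ∈ e.baseSet)
    (v w : F) :
    ContDiffAt ℝ ∞ (fun y => h.inner ((extChartAt (𝓡 n) b).symm y)
      (e.symm ((extChartAt (𝓡 n) b).symm y) v) (e.symm ((extChartAt (𝓡 n) b).symm y) w)) y := by
  rw [← contMDiffAt_iff_contDiffAt]
  exact ContMDiffAt.comp (g := fun b => h.inner b (e.symm b v) (e.symm b w)) y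
    (contMDiffAt_inner_symm h e hb v w)
    ((contMDiffOn_extChartAt_symm b).contMDiffAt ((isOpen_extChartAt_target b).mem_nhds hy))

end Metrics

/-! ### The base metric in charts. -/

section Tangent

variable {n : ℕ} {B : Type*} [TopologicalSpace B] [ChartedSpace (EuclideanSpace ℝ (Fin n)) B]
  [IsManifold (𝓡 n) ∞ B]

/-- Coordinate vector fields form the frame of the tangent bundle trivialization at `b`, so the
components of `g` are a Gram matrix and the results on fibre metrics apply to them. -/
theorem mfderiv_extChartAt_symm_eq (b : B) {y : EuclideanSpace ℝ (Fin n)}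
    (hy : y ∈ (extChartAt (𝓡 n) b).target) (v : EuclideanSpace ℝ (Fin n)) :
    mfderiv 𝓘(ℝ, EuclideanSpace ℝ (Fin n)) (𝓡 n) (extChartAt (𝓡 n) b).symm y v
      = (trivializationAt (EuclideanSpace ℝ (Fin n)) (TangentSpace (𝓡 n)) b).symm
          ((extChartAt (𝓡 n) b).symm y) v := by
  have hmem : (extChartAt (𝓡 n) b).symm y ∈ (chartAt (EuclideanSpace ℝ (Fin n)) b).source := by
    rw [← extChartAt_source (𝓡 n)]
    exact (extChartAt (𝓡 n) b).map_target hy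
  have h := TangentBundle.symmL_trivializationAt (I := 𝓡 n) hmem
  rw [(extChartAt (𝓡 n) b).right_inv hy] at h
  have h2 := congrArg (fun L => L v) h
  rw [Bundle.Trivialization.symmL_apply _ hmem] at h2
  simp only [ModelWithCorners.range_eq_univ, mfderivWithin_univ] at h2
  exact h2.symm

theorem matSmoothAt_chartMetric (g : ContMDiffRiemannianMetric (𝓡 n) ∞ (EuclideanSpace ℝ (Fin n))
      (fun b : B => TangentSpace (𝓡 n) b)) (b : B) {y : EuclideanSpace ℝ (Fin n)}
    (hy : y ∈ (extChartAt (𝓡 n) b).target) :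
    MatSmoothAt (chartMetric (𝓡 n) (stdBasis n) (fun b u v => g.inner b u v) b) y := by
  intro i j
  have hmem : (extChartAt (𝓡 n) b).symm y ∈ (trivializationAt (EuclideanSpace ℝ (Fin n))
      (TangentSpace (𝓡 n)) b).baseSet := by
    rw [TangentBundle.trivializationAt_baseSet, ← extChartAt_source (𝓡 n)]
    exact (extChartAt (𝓡 n) b).map_target hy
  refine (contDiffAt_inner_symm g (trivializationAt (EuclideanSpace ℝ (Fin n))
    (TangentSpace (𝓡 n)) b) hy hmem (stdBasis n i) (stdBasis n j)).congr_of_eventuallyEq ?_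
  filter_upwards [(isOpen_extChartAt_target b).mem_nhds hy] with z hz
  rw [chartMetric, Matrix.of_apply, mfderiv_extChartAt_symm_eq b hz, mfderiv_extChartAt_symm_eq b hz]

end Tangent

/-! ### Positive definiteness of Gram matrices. -/

section Gram

/-- The Gram matrix of a positive-definite form in a basis is positive definite. -/
theorem posDef_gram {V ι : Type*} [AddCommGroup V] [Module ℝ V] [TopologicalSpace V] [Fintype ι]
    [DecidableEq ι]
    (q : V →L[ℝ] V →L[ℝ] ℝ) (hs : ∀ v w, q v w = q w v) (hp : ∀ v, v ≠ 0 → 0 < q v v)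
    {e : ι → V} (he : LinearIndependent ℝ e) :
    (Matrix.of fun i j => q (e i) (e j)).PosDef := by
  refine Matrix.PosDef.of_dotProduct_mulVec_pos ?_ ?_
  · ext i j
    simpa using hs (e j) (e i)
  · intro x hx
    have h0 : ∑ i, x i • e i ≠ 0 := fun h =>
      hx (funext fun i => Fintype.linearIndependent_iff.1 he x h i)
    have h1 := hp _ h0
    convert! h1 using 1
    simp only [map_sum, map_smul, dotProduct, Matrix.mulVec, star_trivial, Matrix.of_apply,
      sum_apply, smul_apply, smul_eq_mul, Finset.mul_sum]
    rw [Finset.sum_comm]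
    refine Finset.sum_congr rfl fun i _ => Finset.sum_congr rfl fun j _ => ?_
    ring

end Gram

/-! ### The total space, its metric and its radial field in flat charts. -/

section Bundle

variable {n N : ℕ} {B : Type*} [TopologicalSpace B] [ChartedSpace (EuclideanSpace ℝ (Fin n)) B]
  [IsManifold (𝓡 n) ∞ B]
  {E : B → Type*} [∀ b, AddCommGroup (E b)] [∀ b, Module ℝ (E b)]
  [∀ b, TopologicalSpace (E b)] [∀ b, IsTopologicalAddGroup (E b)]
  [∀ b, ContinuousConstSMul ℝ (E b)] [TopologicalSpace (TotalSpace (EuclideanSpace ℝ (Fin N)) E)]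
  [FiberBundle (EuclideanSpace ℝ (Fin N)) E] [VectorBundle ℝ (EuclideanSpace ℝ (Fin N)) E]

theorem contMDiffVectorBundle_of_flat [FlatVectorBundle (EuclideanSpace ℝ (Fin N)) E] :
    ContMDiffVectorBundle ∞ (EuclideanSpace ℝ (Fin N)) E (𝓡 n) :=
  ⟨fun e e' _ _ b hb => (contMDiffAt_const.congr_of_eventuallyEq
    (FlatVectorBundle.locallyConstant_coordChange e e' b hb)).contMDiffWithinAt⟩

theorem linearIndependent_symm {F : Type*} [NormedAddCommGroup F] [NormedSpace ℝ F]
    {E : B → Type*} [∀ b, AddCommGroup (E b)] [∀ b, Module ℝ (E b)]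
    [∀ b, TopologicalSpace (E b)] [TopologicalSpace (TotalSpace F E)]
    [FiberBundle F E] [VectorBundle ℝ F E]
    (e : Trivialization F (π F E)) [MemTrivializationAtlas e] {b : B}
    (hb : b ∈ e.baseSet) {ι : Type*} (β : Module.Basis ι ℝ F) :
    LinearIndependent ℝ fun i => e.symm b (β i) :=
  β.linearIndependent.map' (e.linearEquivAt ℝ b hb).symm.toLinearMap
    (LinearEquiv.ker _)

theorem isOpen_flatDomain (b : B) : IsOpen (flatDomain n N E b) :=
  (continuousOn_extChartAt_symm b).isOpen_inter_preimage (isOpen_extChartAt_target b)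
    (trivializationAt (EuclideanSpace ℝ (Fin N)) E b).open_baseSet

theorem localData_flatDomain [ContMDiffVectorBundle ∞ (EuclideanSpace ℝ (Fin N)) E (𝓡 n)]
    (g : ContMDiffRiemannianMetric (𝓡 n) ∞ (EuclideanSpace ℝ (Fin n))
      (fun b : B => TangentSpace (𝓡 n) b))
    (h : ContMDiffRiemannianMetric (𝓡 n) ∞ (EuclideanSpace ℝ (Fin N)) E)
    (hvol : VolumePreserving (N := N) (fun b v w => h.inner b v w)) (b : B) :
    LocalData (flatDomain n N E b)
      (chartMetric (𝓡 n) (stdBasis n) (fun b u v => g.inner b u v) b)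
      (localG (N := N) (fun b v w => h.inner b v w) b) where
  isOpen := isOpen_flatDomain b
  smooth_base y hy := matSmoothAt_chartMetric g b hy.1
  posDef_base y hy := by
    have hmem : (extChartAt (𝓡 n) b).symm y ∈ (trivializationAt (EuclideanSpace ℝ (Fin n))
        (TangentSpace (𝓡 n)) b).baseSet := by
      rw [TangentBundle.trivializationAt_baseSet, ← extChartAt_source (𝓡 n)]
      exact (extChartAt (𝓡 n) b).map_target hy.1
    have := posDef_gram (g.inner ((extChartAt (𝓡 n) b).symm y)) (g.symm _) (g.pos _)
      (linearIndependent_symm _ hmem (stdBasis n))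
    convert! this using 1
    ext i j
    rw [chartMetric, Matrix.of_apply, mfderiv_extChartAt_symm_eq b hy.1,
      mfderiv_extChartAt_symm_eq b hy.1]
    rfl
  smooth_fiber y hy i j := contDiffAt_inner_symm h _ hy.1 hy.2 (stdBasis N i) (stdBasis N j)
  posDef_fiber y hy := posDef_gram (h.inner ((extChartAt (𝓡 n) b).symm y)) (h.symm _) (h.pos _)
      (linearIndependent_symm _ hy.2 (stdBasis N))
  det_fiber y hy :=
    ((continuousOn_extChartAt_symm b).continuousAt
      ((isOpen_extChartAt_target b).mem_nhds hy.1)).eventually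
      (hvol (trivializationAt (EuclideanSpace ℝ (Fin N)) E b) _ hy.2)

variable (p : TotalSpace (EuclideanSpace ℝ (Fin N)) E)

/-- A chart of the total space is a base chart times a linear trivialization, so the fibre
coordinate is unrestricted. -/
theorem mem_target_iff (z : EuclideanSpace ℝ (Fin n) × EuclideanSpace ℝ (Fin N)) :
    z ∈ (extChartAt (totalModel n N) p).target ↔ z.1 ∈ flatDomain n N E p.proj := by
  rw [FiberBundle.extChartAt_target]
  simp [flatDomain]

theorem extChartAt_total_symm_apply (z : EuclideanSpace ℝ (Fin n) × EuclideanSpace ℝ (Fin N)) :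
    (extChartAt (totalModel n N) p).symm z
      = (trivializationAt (EuclideanSpace ℝ (Fin N)) E p.proj).toOpenPartialHomeomorph.symm
        ((extChartAt (𝓡 n) p.proj).symm z.1, z.2) := by
  rw [FiberBundle.extChartAt]
  rfl

theorem extChartAt_total_apply (q : TotalSpace (EuclideanSpace ℝ (Fin N)) E) :
    extChartAt (totalModel n N) p q
      = (extChartAt (𝓡 n) p.proj (trivializationAt (EuclideanSpace ℝ (Fin N)) E p.proj q).1,
        (trivializationAt (EuclideanSpace ℝ (Fin N)) E p.proj q).2) := by
  rw [FiberBundle.extChartAt]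
  rfl

variable {p} {z : EuclideanSpace ℝ (Fin n) × EuclideanSpace ℝ (Fin N)}

theorem proj_extChartAt_total_symm (hz : z.1 ∈ flatDomain n N E p.proj) :
    ((extChartAt (totalModel n N) p).symm z).proj = (extChartAt (𝓡 n) p.proj).symm z.1 := by
  rw [extChartAt_total_symm_apply]
  exact (trivializationAt (EuclideanSpace ℝ (Fin N)) E p.proj).proj_symm_apply' hz.2

theorem trivializationAt_extChartAt_total_symm (hz : z.1 ∈ flatDomain n N E p.proj) :
    trivializationAt (EuclideanSpace ℝ (Fin N)) E p.proj ((extChartAt (totalModel n N) p).symm z)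
      = ((extChartAt (𝓡 n) p.proj).symm z.1, z.2) := by
  rw [extChartAt_total_symm_apply]
  exact (trivializationAt (EuclideanSpace ℝ (Fin N)) E p.proj).apply_symm_apply' hz.2

theorem eventually_mem_flatDomain (hz : z.1 ∈ flatDomain n N E p.proj) :
    ∀ᶠ w : EuclideanSpace ℝ (Fin n) × EuclideanSpace ℝ (Fin N) in 𝓝 z,
      w.1 ∈ flatDomain n N E p.proj :=
  ((isOpen_flatDomain p.proj).preimage continuous_fst).mem_nhds hz

variable [ContMDiffVectorBundle ∞ (EuclideanSpace ℝ (Fin N)) E (𝓡 n)]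

theorem mdifferentiableAt_extChartAt_total_symm (hz : z.1 ∈ flatDomain n N E p.proj) :
    MDifferentiableAt 𝓘(ℝ, EuclideanSpace ℝ (Fin n) × EuclideanSpace ℝ (Fin N)) (totalModel n N)
      (extChartAt (totalModel n N) p).symm z := by
  have : IsManifold (totalModel n N) ∞ (TotalSpace (EuclideanSpace ℝ (Fin N)) E) := inferInstance
  have : IsManifold (totalModel n N) 1 (TotalSpace (EuclideanSpace ℝ (Fin N)) E) := inferInstance
  exact (mdifferentiableOn_extChartAt_symm (I := totalModel n N) (x := p)).mdifferentiableAt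
    ((isOpen_extChartAt_target p).mem_nhds ((mem_target_iff p z).2 hz))

/-- In these coordinates the bundle projection is the first component; the chain rule is applied to
both factorizations. -/
theorem mfderiv_proj_mfderiv_symm (hz : z.1 ∈ flatDomain n N E p.proj)
    (u : EuclideanSpace ℝ (Fin n) × EuclideanSpace ℝ (Fin N)) :
    (mfderiv (totalModel n N) (𝓡 n) (π (EuclideanSpace ℝ (Fin N)) E)
      ((extChartAt (totalModel n N) p).symm z)
      (mfderiv 𝓘(ℝ, EuclideanSpace ℝ (Fin n) × EuclideanSpace ℝ (Fin N)) (totalModel n N)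
        (extChartAt (totalModel n N) p).symm z u) : EuclideanSpace ℝ (Fin n))
      = mfderiv 𝓘(ℝ, EuclideanSpace ℝ (Fin n)) (𝓡 n) (extChartAt (𝓡 n) p.proj).symm z.1 u.1 := by
  have h1 := mfderiv_comp z (I := 𝓘(ℝ, EuclideanSpace ℝ (Fin n) × EuclideanSpace ℝ (Fin N)))
    (I' := totalModel n N) (I'' := 𝓡 n) (g := π (EuclideanSpace ℝ (Fin N)) E)
    (f := (extChartAt (totalModel n N) p).symm)
    ((contMDiff_proj E (n := 1)).mdifferentiable (by simp) _)
    (mdifferentiableAt_extChartAt_total_symm hz)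
  have h2 : π (EuclideanSpace ℝ (Fin N)) E ∘ (extChartAt (totalModel n N) p).symm
      =ᶠ[𝓝 z] (extChartAt (𝓡 n) p.proj).symm ∘ Prod.fst :=
    (eventually_mem_flatDomain hz).mono fun w hw => proj_extChartAt_total_symm hw
  have h3 := mfderiv_comp z (I := 𝓘(ℝ, EuclideanSpace ℝ (Fin n) × EuclideanSpace ℝ (Fin N)))
    (I' := 𝓘(ℝ, EuclideanSpace ℝ (Fin n))) (I'' := 𝓡 n) (g := (extChartAt (𝓡 n) p.proj).symm)
    (f := Prod.fst)
    ((mdifferentiableOn_extChartAt_symm (I := 𝓡 n) (x := p.proj)).mdifferentiableAt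
    ((isOpen_extChartAt_target p.proj).mem_nhds hz.1))
    differentiableAt_fst.mdifferentiableAt
  rw [h2.mfderiv_eq, h3] at h1
  have h4 := congrArg (fun L => L u) h1
  refine h4.symm.trans ?_
  change mfderiv 𝓘(ℝ, EuclideanSpace ℝ (Fin n)) (𝓡 n) (extChartAt (𝓡 n) p.proj).symm z.1
    (mfderiv 𝓘(ℝ, EuclideanSpace ℝ (Fin n) × EuclideanSpace ℝ (Fin N))
      𝓘(ℝ, EuclideanSpace ℝ (Fin n)) Prod.fst z u) = _
  rw [mfderiv_eq_fderiv, fderiv_fst]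
  rfl

/-- `verticalPart` uses the trivialization at the foot of the given point, the chart uses the one at
`p`. By flatness they differ near the point by a constant linear map `C`, so differentiation sees
only the fibre component, and the inverse trivialization undoes `C`. -/
theorem verticalPart_mfderiv_symm [FlatVectorBundle (EuclideanSpace ℝ (Fin N)) E]
    (hz : z.1 ∈ flatDomain n N E p.proj)
    (u : EuclideanSpace ℝ (Fin n) × EuclideanSpace ℝ (Fin N)) :
    verticalPart ((extChartAt (totalModel n N) p).symm z)
      (mfderiv 𝓘(ℝ, EuclideanSpace ℝ (Fin n) × EuclideanSpace ℝ (Fin N)) (totalModel n N)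
        (extChartAt (totalModel n N) p).symm z u)
      = (trivializationAt (EuclideanSpace ℝ (Fin N)) E p.proj).symm
        ((extChartAt (totalModel n N) p).symm z).proj u.2 := by
  set q := (extChartAt (totalModel n N) p).symm z with hq
  set e := trivializationAt (EuclideanSpace ℝ (Fin N)) E p.proj with he
  set e' := trivializationAt (EuclideanSpace ℝ (Fin N)) E q.proj with he'
  have hqp : q.proj = (extChartAt (𝓡 n) p.proj).symm z.1 := proj_extChartAt_total_symm hz
  have hqe' : q.proj ∈ e'.baseSet := mem_baseSet_trivializationAt _ _ _
  have hqe : q.proj ∈ e.baseSet := by rw [hqp]; exact hz.2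
  have hdiff : MDifferentiableAt (totalModel n N) 𝓘(ℝ, EuclideanSpace ℝ (Fin N))
      (fun q' : TotalSpace (EuclideanSpace ℝ (Fin N)) E => (e' q').2) q := by
    have h1 : ContMDiffAt (totalModel n N) (totalModel n N) 1 e' q :=
      (e'.contMDiffOn (IB := 𝓡 n) (n := 1)).contMDiffAt
        (e'.open_source.mem_nhds (e'.mem_source.2 hqe'))
    exact (contMDiffAt_snd.comp q h1).mdifferentiableAt (by simp)
  have h1 := mfderiv_comp z (I := 𝓘(ℝ, EuclideanSpace ℝ (Fin n) × EuclideanSpace ℝ (Fin N)))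
    (I' := totalModel n N) (I'' := 𝓘(ℝ, EuclideanSpace ℝ (Fin N)))
    (g := fun q' : TotalSpace (EuclideanSpace ℝ (Fin N)) E => (e' q').2)
    (f := (extChartAt (totalModel n N) p).symm) hdiff
    (mdifferentiableAt_extChartAt_total_symm hz)
  set C : EuclideanSpace ℝ (Fin N) →L[ℝ] EuclideanSpace ℝ (Fin N) :=
    (e.coordChangeL ℝ e' q.proj : EuclideanSpace ℝ (Fin N) →L[ℝ] EuclideanSpace ℝ (Fin N)) with hC
  have hcont : Filter.Tendsto (fun w : EuclideanSpace ℝ (Fin n) × EuclideanSpace ℝ (Fin N) =>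
      (extChartAt (𝓡 n) p.proj).symm w.1) (𝓝 z) (𝓝 q.proj) := by
    rw [hqp]
    exact ContinuousAt.comp (g := (extChartAt (𝓡 n) p.proj).symm) (f := Prod.fst)
      ((continuousOn_extChartAt_symm p.proj).continuousAt
      ((isOpen_extChartAt_target p.proj).mem_nhds hz.1)) continuousAt_fst
  have h2 : (fun q' : TotalSpace (EuclideanSpace ℝ (Fin N)) E => (e' q').2)
      ∘ (extChartAt (totalModel n N) p).symm =ᶠ[𝓝 z] fun w => C w.2 := by
    filter_upwards [eventually_mem_flatDomain hz,
      hcont.eventually (FlatVectorBundle.locallyConstant_coordChange e e' q.proj ⟨hqe, hqe'⟩),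
      hcont.eventually (e'.open_baseSet.mem_nhds hqe')] with w hw hw1 hw2
    rw [hC, ← hw1, Function.comp_apply, extChartAt_total_symm_apply, ContinuousLinearEquiv.coe_coe,
      Bundle.Trivialization.coordChangeL_apply' e e' ⟨hw.2, hw2⟩]
  rw [h2.mfderiv_eq, mfderiv_eq_fderiv] at h1
  have h3 : fderiv ℝ (fun w : EuclideanSpace ℝ (Fin n) × EuclideanSpace ℝ (Fin N) => C w.2) z
      = C.comp (ContinuousLinearMap.snd ℝ _ _) :=
    (C.comp (ContinuousLinearMap.snd ℝ (EuclideanSpace ℝ (Fin n))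
      (EuclideanSpace ℝ (Fin N)))).hasFDerivAt.fderiv
  rw [h3] at h1
  have h4 := congrArg (fun L => L u) h1
  rw [verticalPart]
  refine (congrArg (e'.symm q.proj) h4.symm).trans ?_
  change e'.symm q.proj (C u.2) = _
  rw [hC, ContinuousLinearEquiv.coe_coe, Bundle.Trivialization.coordChangeL_apply e e' ⟨hqe, hqe'⟩,
    e'.symm_apply_apply_mk hqe']

theorem chartMetric_total [FlatVectorBundle (EuclideanSpace ℝ (Fin N)) E]
    (g : ContMDiffRiemannianMetric (𝓡 n) ∞ (EuclideanSpace ℝ (Fin n))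
      (fun b : B => TangentSpace (𝓡 n) b))
    (h : ContMDiffRiemannianMetric (𝓡 n) ∞ (EuclideanSpace ℝ (Fin N)) E)
    (hz : z.1 ∈ flatDomain n N E p.proj) :
    chartMetric (totalModel n N) (totalBasis n N)
      (totalMetric (fun b u v => g.inner b u v) (fun b v w => h.inner b v w)) p z
      = blockMetric (EuclideanSpace ℝ (Fin N))
        (chartMetric (𝓡 n) (stdBasis n) (fun b u v => g.inner b u v) p.proj)
        (localG (N := N) (fun b v w => h.inner b v w) p.proj) z := by
  have key : ∀ u v : EuclideanSpace ℝ (Fin n) × EuclideanSpace ℝ (Fin N),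
      totalMetric (fun b u v => g.inner b u v) (fun b v w => h.inner b v w)
        ((extChartAt (totalModel n N) p).symm z)
        (mfderiv 𝓘(ℝ, EuclideanSpace ℝ (Fin n) × EuclideanSpace ℝ (Fin N)) (totalModel n N)
          (extChartAt (totalModel n N) p).symm z u)
        (mfderiv 𝓘(ℝ, EuclideanSpace ℝ (Fin n) × EuclideanSpace ℝ (Fin N)) (totalModel n N)
          (extChartAt (totalModel n N) p).symm z v)
      = g.inner ((extChartAt (𝓡 n) p.proj).symm z.1)
          (mfderiv 𝓘(ℝ, EuclideanSpace ℝ (Fin n)) (𝓡 n) (extChartAt (𝓡 n) p.proj).symm z.1 u.1)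
          (mfderiv 𝓘(ℝ, EuclideanSpace ℝ (Fin n)) (𝓡 n) (extChartAt (𝓡 n) p.proj).symm z.1 v.1)
        + h.inner ((extChartAt (𝓡 n) p.proj).symm z.1)
          ((trivializationAt (EuclideanSpace ℝ (Fin N)) E p.proj).symm _ u.2)
          ((trivializationAt (EuclideanSpace ℝ (Fin N)) E p.proj).symm _ v.2) := by
    intro u v
    rw [totalMetric, verticalPart_mfderiv_symm hz, verticalPart_mfderiv_symm hz]
    congr 1
    · have h1 := mfderiv_proj_mfderiv_symm hz u
      have h2 := mfderiv_proj_mfderiv_symm hz v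
      -- All tangent spaces are the model space; forgetting the dependence on the base point allows
      -- the points to be identified by a propositional equality.
      let gf : B → EuclideanSpace ℝ (Fin n) → EuclideanSpace ℝ (Fin n) → ℝ :=
        fun b u v => g.inner b u v
      have h3 : ∀ {b b' : B} {u u' v v' : EuclideanSpace ℝ (Fin n)}, b = b' → u = u' → v = v' →
          gf b u v = gf b' u' v' := by
        rintro _ _ _ _ _ _ rfl rfl rfl
        rfl
      exact h3 (proj_extChartAt_total_symm hz) h1 h2
    · rw [proj_extChartAt_total_symm hz]
  ext i j
  rw [chartMetric, Matrix.of_apply, key]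
  have hs : (trivializationAt (EuclideanSpace ℝ (Fin N)) E p.proj).symm
      ((extChartAt (𝓡 n) p.proj).symm z.1) 0 = 0 := by
    rw [← Bundle.Trivialization.symmₗ_apply (R := ℝ) _ hz.2, LinearMap.map_zero]
  have hm := map_zero
    (mfderiv 𝓘(ℝ, EuclideanSpace ℝ (Fin n)) (𝓡 n) (extChartAt (𝓡 n) p.proj).symm z.1)
  have e1 : ∀ i, totalBasis n N (Sum.inl i) = (stdBasis n i, 0) := fun i => by
    simp [Module.Basis.prod_apply]
  have e2 : ∀ i, totalBasis n N (Sum.inr i) = (0, stdBasis N i) := fun i => by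
    simp [Module.Basis.prod_apply]
  rcases i with i | i <;> rcases j with j | j <;> simp only [e1, e2, hs]
  · rw [map_zero, add_zero]
    rfl
  · erw [hm]
    rw [map_zero, map_zero, zero_apply, add_zero]
    rfl
  · erw [hm]
    rw [map_zero, map_zero, zero_apply, add_zero]
    rfl
  · erw [hm]
    rw [map_zero, zero_add]
    rfl

/-- Trivializations are linear on fibres, so the curve `s ↦ s • q` reads $(z_1, s z_2)$ in the
chart, with velocity $(0, z_2)$ at $s = 1$. -/
theorem chartField_radialField (hz : z.1 ∈ flatDomain n N E p.proj) (c : ℝ) (k : Fin n ⊕ Fin N) :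
    chartField (totalModel n N) (totalBasis n N)
      (fun p : TotalSpace (EuclideanSpace ℝ (Fin N)) E => c • radialField (n := n) p) p z k
      = (totalBasis n N).repr (0, c • z.2) k := by
  have : IsManifold (totalModel n N) ∞ (TotalSpace (EuclideanSpace ℝ (Fin N)) E) := inferInstance
  have : IsManifold (totalModel n N) 1 (TotalSpace (EuclideanSpace ℝ (Fin N)) E) := inferInstance
  rw [chartField]
  congr 2
  set q := (extChartAt (totalModel n N) p).symm z with hq
  set e := trivializationAt (EuclideanSpace ℝ (Fin N)) E p.proj with he
  have hqp : q.proj = (extChartAt (𝓡 n) p.proj).symm z.1 := proj_extChartAt_total_symm hz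
  have hqe : q.proj ∈ e.baseSet := by rw [hqp]; exact hz.2
  set γ : ℝ → TotalSpace (EuclideanSpace ℝ (Fin N)) E := fun s => ⟨q.proj, s • q.snd⟩ with hγ
  have hγ1 : γ 1 = q := by simp [hγ]
  have heq : ∀ s, (e (γ s)).2 = s • z.2 := by
    intro s
    have h1 : (e q).2 = z.2 := by rw [hq, trivializationAt_extChartAt_total_symm hz]
    have h2 := (e.linear ℝ hqe).map_smul s q.snd
    rw [← h1]
    exact h2
  have hγd : MDifferentiableAt 𝓘(ℝ, ℝ) (totalModel n N) γ 1 := by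
    have h1 : ContMDiffAt 𝓘(ℝ, ℝ) (totalModel n N) 1 γ 1 := by
      refine (e.contMDiffAt_iff (f := γ) (e.mem_source.2 hqe)).2 ⟨contMDiffAt_const, ?_⟩
      simp only [heq]
      exact (contDiffAt_id.smul contDiffAt_const).contMDiffAt
    exact h1.mdifferentiableAt (by simp)
  have hmem : q ∈ (chartAt (ModelProd (EuclideanSpace ℝ (Fin n)) (EuclideanSpace ℝ (Fin N))) p).source := by
    rw [← extChartAt_source (totalModel n N)]
    exact (extChartAt (totalModel n N) p).map_target ((mem_target_iff p z).2 hz)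
  have hcd : MDifferentiableAt (totalModel n N)
      𝓘(ℝ, EuclideanSpace ℝ (Fin n) × EuclideanSpace ℝ (Fin N)) (extChartAt (totalModel n N) p)
      (γ 1) := by
    rw [hγ1]
    exact mdifferentiableAt_extChartAt hmem
  have h1 := mfderiv_comp 1 hcd hγd
  have h2 : (extChartAt (totalModel n N) p : _ → _) ∘ γ = fun s : ℝ => (z.1, s • z.2) := by
    funext s
    rw [Function.comp_apply, extChartAt_total_apply]
    refine Prod.ext ?_ (heq s)
    have : (e (γ s)).1 = q.proj := e.coe_fst' hqe
    change extChartAt (𝓡 n) p.proj (e (γ s)).1 = z.1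
    rw [this, hqp]
    exact (extChartAt (𝓡 n) p.proj).right_inv hz.1
  have h3 : HasDerivAt (fun s : ℝ => (z.1, s • z.2)) (0, z.2) 1 := by
    have := (hasDerivAt_const (1 : ℝ) z.1).prodMk ((hasDerivAt_id (1 : ℝ)).smul_const z.2)
    simpa using this
  rw [h2, mfderiv_eq_fderiv, h3.hasFDerivAt.fderiv] at h1
  have h4 := congrArg (fun L => L (1 : ℝ)) h1
  let D : TotalSpace (EuclideanSpace ℝ (Fin N)) E →
      EuclideanSpace ℝ (Fin n) × EuclideanSpace ℝ (Fin N) →L[ℝ]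
        EuclideanSpace ℝ (Fin n) × EuclideanSpace ℝ (Fin N) := fun q =>
    mfderiv (totalModel n N) 𝓘(ℝ, EuclideanSpace ℝ (Fin n) × EuclideanSpace ℝ (Fin N))
      (extChartAt (totalModel n N) p) q
  have h5 : D (γ 1) (radialField q) = (0, z.2) := by
    refine Eq.trans ?_ (h4.symm.trans ?_)
    · rfl
    · exact one_smul ℝ ((0 : EuclideanSpace ℝ (Fin n)), z.2)
  rw [hγ1] at h5
  change D q (c • radialField q) = _
  refine (map_smul (D q) c _).trans ?_
  rw [h5]
  simp

end Bundle

/-! ### Assembly of the two equivalences. -/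

section Main

variable {n N : ℕ} {B : Type*} [TopologicalSpace B] [ChartedSpace (EuclideanSpace ℝ (Fin n)) B]
  [IsManifold (𝓡 n) ∞ B]
  {E : B → Type*} [∀ b, AddCommGroup (E b)] [∀ b, Module ℝ (E b)]
  [∀ b, TopologicalSpace (E b)] [∀ b, IsTopologicalAddGroup (E b)]
  [∀ b, ContinuousConstSMul ℝ (E b)] [TopologicalSpace (TotalSpace (EuclideanSpace ℝ (Fin N)) E)]
  [FiberBundle (EuclideanSpace ℝ (Fin N)) E] [VectorBundle ℝ (EuclideanSpace ℝ (Fin N)) E]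
  [FlatVectorBundle (EuclideanSpace ℝ (Fin N)) E]
  (g : ContMDiffRiemannianMetric (𝓡 n) ∞ (EuclideanSpace ℝ (Fin n))
    (fun b : B => TangentSpace (𝓡 n) b))
  (h : ContMDiffRiemannianMetric (𝓡 n) ∞ (EuclideanSpace ℝ (Fin N)) E)

/-- The soliton equation on the total space, in flat coordinates of the base. -/
theorem expandingSolitonEq_iff
    (hvol : VolumePreserving (N := N) (fun b v w => h.inner b v w)) (t : ℝ) :
    ExpandingSolitonEq (totalModel n N) (totalBasis n N)
        (totalMetric (fun b u v => g.inner b u v) (fun b v w => h.inner b v w))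
        (fun p : TotalSpace (EuclideanSpace ℝ (Fin N)) E =>
          (-(1 / (2 * t))) • radialField (n := n) p) t
      ↔ (∀ b : B, ∀ y ∈ flatDomain n N E b, eulerLagrange (stdBasis n)
            (chartMetric (𝓡 n) (stdBasis n) (fun b u v => g.inner b u v) b)
            (localG (N := N) (fun b v w => h.inner b v w) b) y = 0)
        ∧ BaseEq (n := n) (N := N) (fun b u v => g.inner b u v) (fun b v w => h.inner b v w) t := by
  have : ContMDiffVectorBundle ∞ (EuclideanSpace ℝ (Fin N)) E (𝓡 n) := contMDiffVectorBundle_of_flat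
  have key : ∀ (p : TotalSpace (EuclideanSpace ℝ (Fin N)) E)
      (z : EuclideanSpace ℝ (Fin n) × EuclideanSpace ℝ (Fin N)), z.1 ∈ flatDomain n N E p.proj →
      _ := fun p z hz =>
    (localData_flatDomain g h hvol p.proj).soliton_block_iff (stdBasis n) (stdBasis N) hz t
  have hmetric : ∀ (p : TotalSpace (EuclideanSpace ℝ (Fin N)) E)
      (z : EuclideanSpace ℝ (Fin n) × EuclideanSpace ℝ (Fin N)), z.1 ∈ flatDomain n N E p.proj →
      chartMetric (totalModel n N) (totalBasis n N)
        (totalMetric (fun b u v => g.inner b u v) (fun b v w => h.inner b v w)) p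
      =ᶠ[𝓝 z] blockMetric (EuclideanSpace ℝ (Fin N))
        (chartMetric (𝓡 n) (stdBasis n) (fun b u v => g.inner b u v) p.proj)
        (localG (N := N) (fun b v w => h.inner b v w) p.proj) := fun p z hz =>
    (eventually_mem_flatDomain hz).mono fun w hw => chartMetric_total g h hw
  have hfield : ∀ (p : TotalSpace (EuclideanSpace ℝ (Fin N)) E)
      (z : EuclideanSpace ℝ (Fin n) × EuclideanSpace ℝ (Fin N)), z.1 ∈ flatDomain n N E p.proj →
      chartField (totalModel n N) (totalBasis n N)
        (fun p : TotalSpace (EuclideanSpace ℝ (Fin N)) E =>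
          (-(1 / (2 * t))) • radialField (n := n) p) p
      =ᶠ[𝓝 z] fun q k => (totalBasis n N).repr (0, (-(1 / (2 * t))) • q.2) k := fun p z hz =>
    (eventually_mem_flatDomain hz).mono fun w hw =>
      funext fun k => chartField_radialField hw _ k
  constructor
  · intro hsol
    -- Both conditions on the base involve only the base coordinate, so it suffices to evaluate on
    -- the zero section, in the chart centred at the zero vector over `b`.
    have hall := fun (b : B) (y : EuclideanSpace ℝ (Fin n)) (hy : y ∈ flatDomain n N E b) =>
      (key ⟨b, 0⟩ (y, 0) hy).1 (by
        rw [← ricci_congr (hmetric ⟨b, 0⟩ (y, 0) hy),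
          ← lieDerivMetric_congr (hmetric ⟨b, 0⟩ (y, 0) hy) (hfield ⟨b, 0⟩ (y, 0) hy),
          ← (hmetric ⟨b, 0⟩ (y, 0) hy).self_of_nhds]
        exact hsol ⟨b, 0⟩ (y, 0) ((mem_target_iff _ _).2 hy))
    exact ⟨fun b y hy => (hall b y hy).1, fun b y hy => (hall b y hy).2⟩
  · rintro ⟨h1, h2⟩ p z hz
    rw [mem_target_iff] at hz
    rw [ricci_congr (hmetric p z hz), lieDerivMetric_congr (hmetric p z hz) (hfield p z hz),
      (hmetric p z hz).self_of_nhds]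
    exact (key p z hz).2 ⟨h1 p.proj z.1 hz, h2 p.proj z.1 hz⟩

/-- The fibre metrics are harmonic if and only if the Euler-Lagrange equation holds. -/
theorem fiberMetricHarmonic_iff
    (hvol : VolumePreserving (N := N) (fun b v w => h.inner b v w)) :
    FiberMetricHarmonic (n := n) (N := N) (fun b u v => g.inner b u v) (fun b v w => h.inner b v w)
      ↔ ∀ b : B, ∀ y ∈ flatDomain n N E b, eulerLagrange (stdBasis n)
          (chartMetric (𝓡 n) (stdBasis n) (fun b u v => g.inner b u v) b)
          (localG (N := N) (fun b v w => h.inner b v w) b) y = 0 := by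
  have : ContMDiffVectorBundle ∞ (EuclideanSpace ℝ (Fin N)) E (𝓡 n) := contMDiffVectorBundle_of_flat
  constructor
  · intro hH b y hy
    obtain ⟨c, Ω, hΩ, hyΩ, hsub, hharm⟩ := hH b y hy
    exact ((localData_flatDomain g h hvol b).mono hsub hΩ).eulerLagrange_eq_zero hharm hyΩ
  · intro hEL b y hy
    have hd := localData_flatDomain g h hvol b
    -- The target needs a single determinant, while $\det G$ is only locally constant on the flat
    -- domain; hence the shrinking to `U`, with `c` the value at `y`.
    obtain ⟨U, hU, hUo, hyU⟩ := eventually_nhds_iff.1 (hd.det_fiber y hy)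
    have hsub : flatDomain n N E b ∩ U ⊆ flatDomain n N E b := inter_subset_left
    have ho : IsOpen (flatDomain n N E b ∩ U) := hd.isOpen.inter hUo
    exact ⟨_, _, ho, ⟨hy, hyU⟩, hsub, (hd.mono hsub ho).isHarmonicMapOn
      (fun z hz => hU z hz.2) (fun z hz => hEL b z hz.1)⟩

end Main

end FlatSoliton

theorem theorem1p2 {n N : ℕ} {B : Type*} [TopologicalSpace B]
    [ChartedSpace (EuclideanSpace ℝ (Fin n)) B] [IsManifold (𝓡 n) ∞ B]
    {E : B → Type*} [∀ b, AddCommGroup (E b)] [∀ b, Module ℝ (E b)]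
    [∀ b, TopologicalSpace (E b)] [∀ b, IsTopologicalAddGroup (E b)]
    [∀ b, ContinuousConstSMul ℝ (E b)]
    [TopologicalSpace (TotalSpace (EuclideanSpace ℝ (Fin N)) E)]
    [FiberBundle (EuclideanSpace ℝ (Fin N)) E] [VectorBundle ℝ (EuclideanSpace ℝ (Fin N)) E]
    [FlatSoliton.FlatVectorBundle (EuclideanSpace ℝ (Fin N)) E]
    (g : ContMDiffRiemannianMetric (𝓡 n) ∞ (EuclideanSpace ℝ (Fin n))
      (fun b : B => TangentSpace (𝓡 n) b))
    (h : ContMDiffRiemannianMetric (𝓡 n) ∞ (EuclideanSpace ℝ (Fin N)) E)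
    (hvol : FlatSoliton.VolumePreserving (N := N) (fun b v w => h.inner b v w))
    (t : ℝ) (ht : 0 < t) :
    FlatSoliton.ExpandingSolitonEq (FlatSoliton.totalModel n N) (FlatSoliton.totalBasis n N)
        (FlatSoliton.totalMetric (fun b u v => g.inner b u v) (fun b v w => h.inner b v w))
        (fun p : TotalSpace (EuclideanSpace ℝ (Fin N)) E =>
          (-(1 / (2 * t))) • FlatSoliton.radialField (n := n) p) t
      ↔ FlatSoliton.FiberMetricHarmonic (n := n) (N := N) (fun b u v => g.inner b u v)
          (fun b v w => h.inner b v w)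
        ∧ FlatSoliton.BaseEq (n := n) (N := N) (fun b u v => g.inner b u v)
          (fun b v w => h.inner b v w) t := by
  rw [FlatSoliton.expandingSolitonEq_iff g h hvol t, FlatSoliton.fiberMetricHarmonic_iff g h hvol]
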